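/- Let $\mathrm{Mod}$ be the bicategory whose objects are small categories, whose hom-categories are the functor categories $\mathrm{Mod}(A,B)=[B^{\mathrm{op}}\times A,\mathrm{Set}]$ (modules, or profunctors, from $A$ to $B$, and natural transformations), with composition $(n\circ m)(c,a)=\int^{b} m(b,a)\times n(c,b)$ and identities the hom-functors. For a functor $p:E\to B$ let $p_*:E\to B$ be the module $p_*(b,e)=B(b,pe)$. Definitions, in a bicategory $\mathscr M$: * A morphism $n:Y\to Z$ is a *right lifter* if every $u:K\to Z$ has a right lifting through $n$: there are $r:K\to Y$ and $\varpi:nr\Rightarrow u$ such that, for all $v:K\to Y$, $\sigma\mapsto\varpi\cdot n\sigma$ is a bijection from 2-cells $v\Rightarrow r$ to 2-cells $nv\Rightarrow u$. * A functor $q:\mathscr E\to\mathscr B$ is a *groupoid fibration* if for all $e\in\mathscr E$ and $\beta:b\to qe$ there are $\chi:e'\to e$ and an isomorphism $b\cong qe'$ whose composite with $q\chi$ is $\beta$, and every morphism of $\mathscr E$ is (strongly) cartesian for $q$. A morphism $p:E\to B$ of $\mathscr M$ is a groupoid fibration if the functor $\mathscr M(K,p):\mathscr M(K,E)\to\mathscr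 M(K,B)$ is one for every object $K$. * A square $\theta:nd\cong pc$, with $d:P\to T$, $c:P\to S$, $n:T\to Y$, $p:S\to Y$, is a *bipullback* if for every $K$ the induced functor from $\mathscr M(K,P)$ to the pseudopullback of $\mathscr M(K,n)$ and $\mathscr M(K,p)$ is an equivalence of categories. * A class of morphisms, called *neat*, is a *calibration* of $\mathscr M$ if: (P0) all equivalences are neat, and any morphism isomorphic to a neat one is neat; (P1) for neat $p$, a composite $p\circ q$ is neat if and only if $q$ is neat; (P2) every neat morphism is a groupoid fibration; (P3) every cospan $S\xrightarrow{p}Y\xleftarrow{n}T$ with $p$ neat and $n$ a right lifter has a bipullback whose projection $P\to T$ is neat. * Let $1$ be a terminal object of the sub-bicategory of left adjoint morphisms of $\mathscr M$ such that, for every $X$, the (unique up to isomorphism) left adjoint $!_X:X\to 1$ is terminal in the category $\mathscr M(X,1)$. A *tabulation* of $u:1\to X$ consists of a left adjoint $p:U\to X$ and a 2-cell $\rho:p\Rightarrow u\,!_U$ such that, for every $K$, the natural transformation with components $pw\xrightarrow{\rho w}u\,!_U w\to u\,!_K$ (for $w\in\mathscr M(K,U)$) exhibits $\mathscr M(K,U)$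 as a bicategorical comma object of the identity functor of $\mathscr M(K,X)$ over the object $u\,!_K$; that is, the comparison functor from $\mathscr M(K,U)$ to the comma category is an equivalence. $\mathrm{Tab}$ is the class of morphisms $p$ which occur in a tabulation of some $u:1\to X$. **Corollary.** The class $\mathrm{Tab}$ is a calibration of $\mathrm{Mod}$. Every morphism of $\mathrm{Mod}$ is a right lifter. Up to equivalence, the neat morphisms are exactly the modules $p_*$ with $p$ a discrete fibration: a module $m:E\to B$ is in $\mathrm{Tab}$ if and only if there are a small category $F$, an equivalence $h:F\to E$ in $\mathrm{Mod}$ and a discrete fibration (functor) $p:F\to B$ such that $m\circ h\cong p_*$. -/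

import Mathlib

open CategoryTheory

universe u

/-! ### Profunctors (modules) and their coend composition -/

namespace ModBicat

open Opposite

section Composition

variable {A B C D : Type u} [SmallCategory A] [SmallCategory B] [SmallCategory C]
  [SmallCategory D]

/-- The relation generating the coend `∫^b P(b, a) × Q(c, b)`. -/
inductive TensorRel (P : Profunctor.{u} A B) (Q : Profunctor.{u} B C) (a : A) (c : Cᵒᵖ) :
    (Σ b : B, (P.obj a).obj (op b) × (Q.obj b).obj c) →
    (Σ b : B, (P.obj a).obj (op b) × (Q.obj b).obj c) → Prop
  | glide {b b' : B} (f : b ⟶ b') (x : (P.obj a).obj (op b')) (y : (Q.obj b).obj c) :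
      TensorRel P Q a c ⟨b, (P.obj a).map f.op x, y⟩ ⟨b', x, (Q.map f).app c y⟩

/-- The coend `∫^b P(b, a) × Q(c, b)` of sets, where `P(b, a)` is `(P.obj a).obj (op b)`. -/
def Tensor (P : Profunctor.{u} A B) (Q : Profunctor.{u} B C) (a : A) (c : Cᵒᵖ) : Type u :=
  Quot (TensorRel P Q a c)

/-- The class of a pair `(x, y)` in the coend. -/
def tmk (P : Profunctor.{u} A B) (Q : Profunctor.{u} B C) (a : A) (c : Cᵒᵖ) (b : B)
    (x : (P.obj a).obj (op b)) (y : (Q.obj b).obj c) : Tensor P Q a c :=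
  Quot.mk _ ⟨b, x, y⟩

theorem tmk_glide (P : Profunctor.{u} A B) (Q : Profunctor.{u} B C) (a : A) (c : Cᵒᵖ)
    {b b' : B} (f : b ⟶ b') (x : (P.obj a).obj (op b')) (y : (Q.obj b).obj c) :
    tmk P Q a c b ((P.obj a).map f.op x) y = tmk P Q a c b' x ((Q.map f).app c y) :=
  Quot.sound (.glide f x y)

/-- The universal property of the coend. -/
def tlift {P : Profunctor.{u} A B} {Q : Profunctor.{u} B C} {a : A} {c : Cᵒᵖ} {T : Type u}
    (φ : ∀ b : B, (P.obj a).obj (op b) → (Q.obj b).obj c → T)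
    (h : ∀ {b b' : B} (f : b ⟶ b') (x : (P.obj a).obj (op b')) (y : (Q.obj b).obj c),
      φ b ((P.obj a).map f.op x) y = φ b' x ((Q.map f).app c y)) :
    Tensor P Q a c → T :=
  Quot.lift (fun t => φ t.1 t.2.1 t.2.2) (by rintro _ _ ⟨f, x, y⟩; exact h f x y)

theorem tensor_ind {P : Profunctor.{u} A B} {Q : Profunctor.{u} B C} {a : A} {c : Cᵒᵖ}
    {motive : Tensor P Q a c → Prop} (h : ∀ b x y, motive (tmk P Q a c b x y)) (t) : motive t :=
  Quot.ind (fun s => h s.1 s.2.1 s.2.2) t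

theorem app_obj_map {P P' : Profunctor.{u} A B} (η : P ⟶ P') (a : A) {b b' : Bᵒᵖ} (f : b ⟶ b')
    (x : (P.obj a).obj b) :
    (η.app a).app b' ((P.obj a).map f x) = (P'.obj a).map f ((η.app a).app b x) :=
  ConcreteCategory.congr_hom ((η.app a).naturality f) x

theorem app_map_app {P P' : Profunctor.{u} A B} (η : P ⟶ P') {a a' : A} (b : Bᵒᵖ) (f : a ⟶ a')
    (x : (P.obj a).obj b) :
    (η.app a').app b ((P.map f).app b x) = (P'.map f).app b ((η.app a).app b x) :=
  ConcreteCategory.congr_hom (NatTrans.congr_app (η.naturality f) b) x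

theorem map_app_obj_map (P : Profunctor.{u} A B) {a a' : A} {b b' : Bᵒᵖ} (f : a ⟶ a')
    (g : b ⟶ b') (x : (P.obj a).obj b) :
    (P.map f).app b' ((P.obj a).map g x) = (P.obj a').map g ((P.map f).app b x) :=
  ConcreteCategory.congr_hom ((P.map f).naturality g) x

theorem map_comp_apply (P : Profunctor.{u} A B) {a a' a'' : A} (b : Bᵒᵖ) (f : a ⟶ a')
    (g : a' ⟶ a'') (x : (P.obj a).obj b) :
    (P.map (f ≫ g)).app b x = (P.map g).app b ((P.map f).app b x) := by
  simp

theorem map_id_apply (P : Profunctor.{u} A B) (a : A) (b : Bᵒᵖ) (x : (P.obj a).obj b) :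
    (P.map (𝟙 a)).app b x = x := by
  simp

theorem obj_map_comp_apply (P : Profunctor.{u} A B) (a : A) {b b' b'' : Bᵒᵖ} (f : b ⟶ b')
    (g : b' ⟶ b'') (x : (P.obj a).obj b) :
    (P.obj a).map (f ≫ g) x = (P.obj a).map g ((P.obj a).map f x) := by
  simp

theorem obj_map_id_apply (P : Profunctor.{u} A B) (a : A) (b : Bᵒᵖ) (x : (P.obj a).obj b) :
    (P.obj a).map (𝟙 b) x = x := by
  simp

theorem prof_hom_ext {P Q : Profunctor.{u} A B} {η θ : P ⟶ Q}
    (h : ∀ a b (x : (P.obj a).obj b), (η.app a).app b x = (θ.app a).app b x) : η = θ := by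
  ext a b x
  exact h a b x

/-- Composition of profunctors `P : A ⇸ B` and `Q : B ⇸ C`: at `(c, a)` it is the coend
`∫^b P(b, a) × Q(c, b)`. -/
def comp (P : Profunctor.{u} A B) (Q : Profunctor.{u} B C) : Profunctor.{u} A C where
  obj a :=
    { obj := fun c => Tensor P Q a c
      map := fun {c c'} g => ↾(tlift (fun b x y => tmk P Q a c' b x ((Q.obj b).map g y))
        (fun f x y => (tmk_glide P Q a c' f x _).trans
          (congrArg (tmk P Q a c' _ x) (map_app_obj_map Q f g y))))
      map_id := fun c => by
        ext t
        induction t using tensor_ind with | h b x y =>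
        exact congrArg (tmk P Q a c b x) (obj_map_id_apply Q b c y)
      map_comp := fun {_ _ c} g g' => by
        ext t
        induction t using tensor_ind with | h b x y =>
        exact congrArg (tmk P Q a c b x) (obj_map_comp_apply Q b g g' y) }
  map {a a'} f :=
    { app := fun c => ↾(tlift (fun b x y => tmk P Q a' c b ((P.map f).app (op b) x) y)
        (fun {b b'} g x y => (congrArg (fun z => tmk P Q a' c b z y)
          (map_app_obj_map P f g.op x)).trans (tmk_glide P Q a' c g _ y)))
      naturality := fun c c' g => by
        ext t
        induction t using tensor_ind with | h b x y => rfl }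
  map_id a := by
    ext c t
    induction t using tensor_ind with | h b x y =>
    exact congrArg (fun z => tmk P Q a c b z y) (map_id_apply P a (op b) x)
  map_comp {_ _ a} f g := by
    ext c t
    induction t using tensor_ind with | h b x y =>
    exact congrArg (fun z => tmk P Q a c b z y) (map_comp_apply P (op b) f g x)

/-- Horizontal composition of natural transformations between profunctors. -/
def compMap {P P' : Profunctor.{u} A B} {Q Q' : Profunctor.{u} B C} (η : P ⟶ P') (θ : Q ⟶ Q') :
    comp P Q ⟶ comp P' Q' where
  app a :=
    { app := fun c => ↾(tlift
        (fun b x y => tmk P' Q' a c b ((η.app a).app (op b) x) ((θ.app b).app c y))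
        (fun {b b'} f x y =>
          (congrArg (fun z => tmk P' Q' a c b z ((θ.app b).app c y))
            (app_obj_map η a f.op x)).trans
          ((tmk_glide P' Q' a c f _ _).trans
            (congrArg (tmk P' Q' a c b' _) (app_map_app θ c f y).symm))))
      naturality := fun c c' g => by
        ext t
        induction t using tensor_ind with | h b x y =>
        exact congrArg (tmk P' Q' a c' b _) (app_obj_map θ b g y) }
  naturality a a' f := by
    ext c t
    induction t using tensor_ind with | h b x y =>
    exact congrArg (fun z => tmk P' Q' a' c b z ((θ.app b).app c y)) (app_map_app η (op b) f x)

theorem comp_hom_ext {P : Profunctor.{u} A B} {Q : Profunctor.{u} B C} {R : Profunctor.{u} A C}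
    {η θ : comp P Q ⟶ R}
    (h : ∀ a c b x y, (η.app a).app c (tmk P Q a c b x y) = (θ.app a).app c (tmk P Q a c b x y)) :
    η = θ :=
  prof_hom_ext fun a c t => by
    induction t using tensor_ind with | h b x y => exact h a c b x y

/-- The associativity isomorphism `((x, y), z) ↦ (x, (y, z))`. -/
def assoc (P : Profunctor.{u} A B) (Q : Profunctor.{u} B C) (R : Profunctor.{u} C D) :
    comp (comp P Q) R ≅ comp P (comp Q R) where
  hom :=
    { app := fun a =>
        { app := fun d => ↾(tlift
            (fun c t z => tlift (fun b x y => tmk P (comp Q R) a d b x (tmk Q R b d c y z))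
              (fun f x y => tmk_glide P (comp Q R) a d f x _) t)
            (fun {c c'} f t z => by
              induction t using tensor_ind with | h b x y =>
              exact congrArg (tmk P (comp Q R) a d b x) (tmk_glide Q R b d f y z)))
          naturality := fun d d' g => by
            ext t
            induction t using tensor_ind with | h c t z =>
            induction t using tensor_ind with | h b x y => rfl }
      naturality := fun a a' f => by
        ext d t
        induction t using tensor_ind with | h c t z =>
        induction t using tensor_ind with | h b x y => rfl }
  inv :=
    { app := fun a =>
        { app := fun d => ↾(tlift
            (fun b x t => tlift
              (fun c y z => tmk (comp P Q) R a d c (tmk P Q a (op c) b x y) z)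
              (fun {c c'} f y z => tmk_glide (comp P Q) R a d f (tmk P Q a (op c') b x y) z) t)
            (fun {b b'} f x t => by
              induction t using tensor_ind with | h c y z =>
              exact congrArg (fun w => tmk (comp P Q) R a d c w z)
                (tmk_glide P Q a (op c) f x y)))
          naturality := fun d d' g => by
            ext t
            induction t using tensor_ind with | h b x t =>
            induction t using tensor_ind with | h c y z => rfl }
      naturality := fun a a' f => by
        ext d t
        induction t using tensor_ind with | h b x t =>
        induction t using tensor_ind with | h c y z => rfl }
  hom_inv_id := comp_hom_ext fun a d c t z => by
    induction t using tensor_ind with | h b x y => rfl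
  inv_hom_id := comp_hom_ext fun a d b x t => by
    induction t using tensor_ind with | h c y z => rfl

/-- The left unit isomorphism `(f, y) ↦ Q(f) y`. -/
def lunit (Q : Profunctor.{u} A B) : comp (Profunctor.id (C := A)) Q ≅ Q where
  hom :=
    { app := fun a =>
        { app := fun b => ↾(tlift (fun a' (f : a' ⟶ a) y => (Q.map f).app b y)
            (fun f x y => map_comp_apply Q b f x y))
          naturality := fun b b' g => by
            ext t
            induction t using tensor_ind with | h a' f y =>
            exact map_app_obj_map Q f g y }
      naturality := fun a a' f => by
        ext b t
        induction t using tensor_ind with | h a'' g y =>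
        exact map_comp_apply Q b g f y }
  inv :=
    { app := fun a =>
        { app := fun b => ↾(fun y => tmk (Profunctor.id (C := A)) Q a b a (𝟙 a) y)
          naturality := fun b b' g => rfl }
      naturality := fun a a' f => by
        ext b y
        refine (tmk_glide (Profunctor.id (C := A)) Q a' b f (𝟙 a') y).symm.trans ?_
        exact congrArg (fun z => tmk (Profunctor.id (C := A)) Q a' b a z y)
          ((Category.comp_id f).trans (Category.id_comp f).symm) }
  hom_inv_id := comp_hom_ext fun a b a' f y => by
    refine (tmk_glide (Profunctor.id (C := A)) Q a b f (𝟙 a) y).symm.trans ?_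
    exact congrArg (fun z => tmk (Profunctor.id (C := A)) Q a b a' z y) (Category.comp_id f)
  inv_hom_id := prof_hom_ext fun a b y => map_id_apply Q a b y

/-- The right unit isomorphism `(x, f) ↦ P(f) x`. -/
def runit (P : Profunctor.{u} A B) : comp P (Profunctor.id (C := B)) ≅ P where
  hom :=
    { app := fun a =>
        { app := fun b => ↾(tlift
            (fun b' x (f : b.unop ⟶ b') => (P.obj a).map f.op x)
            (fun f x y => (obj_map_comp_apply P a f.op (Quiver.Hom.op y) x).symm))
          naturality := fun b b' g => by
            ext t
            induction t using tensor_ind with | h b'' x f =>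
            exact obj_map_comp_apply P a (Quiver.Hom.op f) g x }
      naturality := fun a a' f => by
        ext b t
        induction t using tensor_ind with | h b' x g =>
        exact (map_app_obj_map P f (Quiver.Hom.op g) x).symm }
  inv :=
    { app := fun a =>
        { app := fun b => ↾(fun x =>
            tmk P (Profunctor.id (C := B)) a b b.unop x (𝟙 b.unop))
          naturality := fun b b' g => by
            ext x
            refine (tmk_glide P (Profunctor.id (C := B)) a b' g.unop x (𝟙 b'.unop)).trans ?_
            exact congrArg (tmk P (Profunctor.id (C := B)) a b' b.unop x)
              ((Category.id_comp g.unop).trans (Category.comp_id g.unop).symm) }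
      naturality := fun a a' f => rfl }
  hom_inv_id := comp_hom_ext fun a b b' x f => by
    refine (tmk_glide P (Profunctor.id (C := B)) a b f x (𝟙 b.unop)).trans ?_
    exact congrArg (tmk P (Profunctor.id (C := B)) a b b' x) (Category.id_comp f)
  inv_hom_id := prof_hom_ext fun a b x => obj_map_id_apply P a b x

theorem comp_hom_ext₃ {P : Profunctor.{u} A B} {Q : Profunctor.{u} B C} {R : Profunctor.{u} C D}
    {S : Profunctor.{u} A D} {η θ : comp (comp P Q) R ⟶ S}
    (h : ∀ a d c b x y z,
      (η.app a).app d (tmk (comp P Q) R a d c (tmk P Q a (op c) b x y) z) =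
        (θ.app a).app d (tmk (comp P Q) R a d c (tmk P Q a (op c) b x y) z)) : η = θ :=
  comp_hom_ext fun a d c t z => by
    induction t using tensor_ind with | h b x y => exact h a d c b x y z

theorem comp_hom_ext₃' {P : Profunctor.{u} A B} {Q : Profunctor.{u} B C} {R : Profunctor.{u} C D}
    {S : Profunctor.{u} A D} {η θ : comp P (comp Q R) ⟶ S}
    (h : ∀ a d b c x y z,
      (η.app a).app d (tmk P (comp Q R) a d b x (tmk Q R b d c y z)) =
        (θ.app a).app d (tmk P (comp Q R) a d b x (tmk Q R b d c y z))) : η = θ :=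
  comp_hom_ext fun a d b x t => by
    induction t using tensor_ind with | h c y z => exact h a d b c x y z

end Composition

end ModBicat

/-- An object of `Mod`: a small category. -/
structure ModCat : Type (u + 1) where
  /-- The underlying type of objects. -/
  carrier : Type u
  [cat : SmallCategory carrier]

attribute [instance] ModCat.cat

namespace ModCat

open ModBicat Opposite

instance : CategoryStruct.{u + 1} ModCat.{u} where
  Hom X Y := Profunctor.{u} X.carrier Y.carrier
  id X := Profunctor.id (C := X.carrier)
  comp P Q := ModBicat.comp P Q

instance (X Y : ModCat.{u}) : Category.{u} (X ⟶ Y) :=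
  inferInstanceAs (Category.{u} (X.carrier ⥤ Y.carrierᵒᵖ ⥤ Type u))

/-- The bicategory `Mod` of small categories, profunctors `m : A ⟶ B`
(functors `A ⥤ Bᵒᵖ ⥤ Type u`, with `m(b, a) = (m.obj a).obj (op b)`) and natural transformations.
In Lean's diagrammatic order, `m ≫ n` is the module `(c, a) ↦ ∫^b m(b, a) × n(c, b)`. -/
instance : Bicategory.{u, u + 1} ModCat.{u} where
  homCategory X Y := inferInstance
  whiskerLeft {X Y Z} P Q Q' η :=
    compMap (P := (P : Profunctor.{u} X.carrier Y.carrier)) (𝟙 _) η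
  whiskerRight {X Y Z P P'} η Q :=
    compMap (Q := (Q : Profunctor.{u} Y.carrier Z.carrier)) η (𝟙 _)
  associator P Q R := assoc P Q R
  leftUnitor P := lunit P
  rightUnitor P := runit P
  whiskerLeft_id P Q := comp_hom_ext fun a c b x y => rfl
  whiskerLeft_comp {_ _ _} P {_ _ _} η θ := comp_hom_ext fun a c b x y => rfl
  id_whiskerLeft {X Y P Q} η := comp_hom_ext fun a c b x y => by
    refine Eq.trans ?_ (congrArg (tmk (Profunctor.id (C := X.carrier)) Q a c a (𝟙 a))
      (app_map_app η c x y).symm)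
    exact (ConcreteCategory.congr_hom
      (NatTrans.congr_app (NatTrans.congr_app (lunit Q).hom_inv_id a) c)
      (tmk (Profunctor.id (C := X.carrier)) Q a c b x ((η.app b).app c y))).symm
  comp_whiskerLeft {_ _ _ _} P Q {_ _} η := comp_hom_ext₃ fun a d c b x y z => rfl
  id_whiskerRight P Q := comp_hom_ext fun a c b x y => rfl
  comp_whiskerRight {_ _ _} {_ _ _} η θ Q := comp_hom_ext fun a c b x y => rfl
  whiskerRight_id {X Y P Q} η := comp_hom_ext fun a c b x y => by
    refine Eq.trans ?_ (congrArg
      (fun z => tmk Q (Profunctor.id (C := Y.carrier)) a c c.unop z (𝟙 c.unop))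
      (app_obj_map η a (Quiver.Hom.op y) x).symm)
    exact (ConcreteCategory.congr_hom
      (NatTrans.congr_app (NatTrans.congr_app (runit Q).hom_inv_id a) c)
      (tmk Q (Profunctor.id (C := Y.carrier)) a c b ((η.app a).app (op b) x) y)).symm
  whiskerRight_comp {_ _ _ _} {_ _} η Q R := comp_hom_ext₃' fun a d c b x y z => rfl
  whisker_assoc {_ _ _ _} P {_ _} η R := comp_hom_ext₃ fun a d c b x y z => rfl
  whisker_exchange {_ _ _} {_ _} {_ _} η θ := comp_hom_ext fun a c b x y => rfl
  pentagon P Q R S := comp_hom_ext₃ fun a d c b t y z => by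
    induction t using tensor_ind with | h b' x y => rfl
  triangle P Q := comp_hom_ext₃ fun a d c b x y z =>
    (tmk_glide P Q a d y x z).symm

/-- The module `p_* : E ⟶ B` of a functor `p`, with `p_*(b, e) = B(b, p e)`. -/
def lowerStar {E B : ModCat.{u}} (p : E.carrier ⥤ B.carrier) : E ⟶ B :=
  (p.toProfunctor : Profunctor.{u} E.carrier B.carrier)

end ModCat

/-! ### Notions in categories -/

/-- A functor `p : E ⥤ B` is a discrete fibration when each `β : b ⟶ p e` has a unique lift
`χ : e' ⟶ e`. -/
def IsDiscreteFibration {E B : Type u} [SmallCategory E] [SmallCategory B] (p : E ⥤ B) : Prop :=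
  ∀ (e : E) (b : B) (β : b ⟶ p.obj e), ∃! χ : (Σ e' : E, e' ⟶ e), p.IsHomLift β χ.2

/-! ### Notions in a bicategory -/

namespace BicatNotions

open Bicategory Limits

universe w v u₁ v₁ u₂ v₂

/-- A functor is a groupoid fibration when morphisms `b ⟶ p e` lift up to isomorphism and every
morphism is (strongly) cartesian. -/
structure IsGroupoidFibrationFunctor {E : Type u₁} {B : Type u₂} [Category.{v₁} E]
    [Category.{v₂} B] (p : E ⥤ B) : Prop where
  exists_lift : ∀ (e : E) (b : B) (β : b ⟶ p.obj e),
    ∃ (e' : E) (χ : e' ⟶ e) (i : b ≅ p.obj e'), i.hom ≫ p.map χ = β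
  cartesian : ∀ {e' e : E} (χ : e' ⟶ e), p.IsStronglyCartesian (p.map χ) χ

variable {M : Type u₁} [Bicategory.{w, v} M]

/-- A morphism of a bicategory is an equivalence when it underlies an (adjoint) equivalence. -/
def IsEquivalenceMor {X Y : M} (f : X ⟶ Y) : Prop :=
  ∃ e : Bicategory.Equivalence X Y, e.hom = f

/-- Groupoid fibrations in a bicategory, defined representably. -/
def IsGroupoidFibration {E B : M} (p : E ⟶ B) : Prop :=
  ∀ K : M, IsGroupoidFibrationFunctor (postcomp K p)

/-- `ϖ : n r ⇒ x` exhibits `r : K ⟶ Y` as a right lifting of `x : K ⟶ Z` through `n : Y ⟶ Z`. -/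
def IsRightLifting {K Y Z : M} (n : Y ⟶ Z) (x : K ⟶ Z) (r : K ⟶ Y) (ϖ : r ≫ n ⟶ x) : Prop :=
  ∀ v : K ⟶ Y, Function.Bijective fun σ : v ⟶ r => σ ▷ n ≫ ϖ

/-- `n` is a right lifter when right liftings through `n` exist. -/
def IsRightLifter {Y Z : M} (n : Y ⟶ Z) : Prop :=
  ∀ (K : M) (x : K ⟶ Z), ∃ (r : K ⟶ Y) (ϖ : r ≫ n ⟶ x), IsRightLifting n x r ϖ

/-- The functor `M(K, P) ⥤ M(K, n) /ₚₛ M(K, p)` induced by a square `θ : n d ≅ p c`, into the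
pseudopullback of `M(K, n)` and `M(K, p)`. -/
def squareFunctor {P T S Y : M} {d : P ⟶ T} {c : P ⟶ S} {n : T ⟶ Y} {p : S ⟶ Y}
    (θ : d ≫ n ≅ c ≫ p) (K : M) :
    (K ⟶ P) ⥤ CategoricalPullback (postcomp K n) (postcomp K p) where
  obj f :=
    { fst := f ≫ d
      snd := f ≫ c
      iso := α_ f d n ≪≫ whiskerLeftIso f θ ≪≫ (α_ f c p).symm }
  map σ :=
    { fst := σ ▷ d
      snd := σ ▷ c
      w := by
        change σ ▷ d ▷ n ≫ (α_ _ d n).hom ≫ _ ◁ θ.hom ≫ (α_ _ c p).inv =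
          ((α_ _ d n).hom ≫ _ ◁ θ.hom ≫ (α_ _ c p).inv) ≫ σ ▷ c ▷ p
        rw [associator_naturality_left_assoc, ← whisker_exchange_assoc]
        simp }

/-- The square `θ : n d ≅ p c` is a bipullback of the cospan `n`, `p`. -/
def IsBipullback {P T S Y : M} {d : P ⟶ T} {c : P ⟶ S} {n : T ⟶ Y} {p : S ⟶ Y}
    (θ : d ≫ n ≅ c ≫ p) : Prop :=
  ∀ K : M, (squareFunctor θ K).IsEquivalence

/-- A calibration of a bicategory: a class of (neat) morphisms satisfying P0-P3. -/
structure IsCalibration (neat : ∀ ⦃X Y : M⦄, (X ⟶ Y) → Prop) : Prop where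
  of_equivalence : ∀ {X Y : M} (f : X ⟶ Y), IsEquivalenceMor f → neat f
  of_iso : ∀ {X Y : M} (p q : X ⟶ Y), neat p → (p ≅ q) → neat q
  comp_iff : ∀ {X Y Z : M} (q : X ⟶ Y) (p : Y ⟶ Z), neat p → (neat (q ≫ p) ↔ neat q)
  groupoidFibration : ∀ {X Y : M} (p : X ⟶ Y), neat p → IsGroupoidFibration p
  exists_bipullback : ∀ {S T Y : M} (p : S ⟶ Y) (n : T ⟶ Y), neat p → IsRightLifter n →
    ∃ (P : M) (p' : P ⟶ T) (n' : P ⟶ S) (θ : p' ≫ n ≅ n' ≫ p), IsBipullback θ ∧ neat p'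

/-- An object `I` that is terminal in the sub-bicategory of left adjoint morphisms and for which
the (unique up to isomorphism) left adjoint `!_X : X ⟶ I` is terminal in `M(X, I)`. Since `!_X` is
terminal in `M(X, I)`, the first requirement is that every left adjoint `X ⟶ I` is isomorphic
to `!_X`. -/
structure StarTerminal (I : M) where
  /-- The morphism `!_X`. -/
  bang (X : M) : X ⟶ I
  isLeftAdjoint_bang (X : M) : IsLeftAdjoint (bang X)
  nonempty_iso (X : M) (f : X ⟶ I) : IsLeftAdjoint f → Nonempty (f ≅ bang X)
  /-- `!_X` is terminal in `M(X, I)`. -/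
  isTerminal (X : M) : IsTerminal (bang X)

/-- The functor from `M(K, U)` to the comma category of `1 : M(K, X) ⥤ M(K, X)` over the object
`x !_K`, which takes `w` to `p w ⟶ x !_U w ⟶ x !_K`. -/
def tabFunctor {I : M} (t : StarTerminal I) {U X : M} {x : I ⟶ X} {p : U ⟶ X}
    (ρ : p ⟶ t.bang U ≫ x) (K : M) :
    (K ⟶ U) ⥤ Comma (𝟭 (K ⟶ X)) (Functor.fromPUnit.{0} (t.bang K ≫ x)) where
  obj f :=
    { left := f ≫ p
      right := ⟨⟨⟩⟩
      hom := f ◁ ρ ≫ (α_ f (t.bang U) x).inv ≫ (t.isTerminal K).from (f ≫ t.bang U) ▷ x }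
  map {f g} σ :=
    { left := σ ▷ p
      right := 𝟙 _
      w := by
        have h : σ ▷ t.bang U ≫ (t.isTerminal K).from (g ≫ t.bang U) =
            (t.isTerminal K).from (f ≫ t.bang U) := (t.isTerminal K).hom_ext _ _
        change σ ▷ p ≫ g ◁ ρ ≫ (α_ g (t.bang U) x).inv ≫ _ ▷ x =
          (f ◁ ρ ≫ (α_ f (t.bang U) x).inv ≫ _ ▷ x) ≫ 𝟙 _
        rw [← h, ← whisker_exchange_assoc]
        simp [- comp_whiskerRight, ← comp_whiskerRight] }

/-- `ρ : p ⇒ x !_U` is a tabulation of `x : I ⟶ X`: `p` is a left adjoint and, for all `K`, the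
square of `M(K, U)` over `1` and `x !_K` is a bicategorical comma square, that is, the comparison
with the comma category is an equivalence. -/
structure IsTabulation {I : M} (t : StarTerminal I) {U X : M} (x : I ⟶ X) (p : U ⟶ X)
    (ρ : p ⟶ t.bang U ≫ x) : Prop where
  isLeftAdjoint : IsLeftAdjoint p
  isEquivalence : ∀ K : M, (tabFunctor t ρ K).IsEquivalence

/-- The class of morphisms that occur in a tabulation of a morphism out of the terminal object. -/
def Tab ⦃U X : M⦄ (p : U ⟶ X) : Prop :=
  ∃ (I : M) (t : StarTerminal I) (x : I ⟶ X) (ρ : p ⟶ t.bang U ≫ x), IsTabulation t x p ρ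

end BicatNotions

namespace BicatNotions

open Bicategory Limits

universe w v u₁

variable {M : Type u₁} [Bicategory.{w, v} M]

/-! ### Equivalences and left adjoints in a bicategory -/

/-! A tabulation `p` of `x` presents each `M(K, U)` as the slice of `M(K, X)` over `x !_K`, with
postcomposition by `p` as the projection. The calibration axioms thereby become facts about slices,
valid in any bicategory with such an object `1` out of which every morphism has a tabulation
(`isCalibration_tab`).

The projection of a slice is a groupoid fibration, which gives P2. A slice of a slice is a slice, so
tabulations compose (`Tabulates.comp`). Conversely, if `p` tabulates `x` and `q ≫ p` tabulates `z`,
then `z` is a left extension of `q ≫ p` along `!` (`Tabulates.exists_desc`). This yields `z ⟶ x`, an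
object of the slice over `x`, hence a morphism `y` which `q` tabulates (`Tabulates.of_comp`). For
P3, a pullback of `p` along `n` classifies 2-cells `a ≫ n ⟶ x !_K`, that is, 2-cells from `a` to the
right lifting of `x !_K` through `n`; so a tabulation of the right lifting of `x` is the pullback
(`Tabulates.exists_isBipullback`).

In `Mod`, a morphism `1 ⟶ X` is a presheaf `W`, and `x !_K` is `W`, constant in `K`. A module with a
map to this constant module splits into its fibres over the elements of `W`, and so amounts to a
module into the category of elements of `W`. Hence the projection of that category, a discrete
fibration, tabulates `W` (`exists_tabulates`). Every discrete fibration is the category of elements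
of its fibres, up to equivalence, and tabulations are unique up to equivalence
(`Tabulates.exists_equivalence`). -/

theorem IsEquivalenceMor.of_isos {X Y : M} {f : X ⟶ Y} {g : Y ⟶ X} (η : 𝟙 X ≅ f ≫ g)
    (e : g ≫ f ≅ 𝟙 Y) : IsEquivalenceMor f :=
  ⟨Equivalence.mkOfAdjointifyCounit η e, rfl⟩

theorem isEquivalenceMor_id (X : M) : IsEquivalenceMor (𝟙 X) :=
  ⟨Equivalence.id X, rfl⟩

theorem isEquivalenceMor_inv {X Y : M} (e : Bicategory.Equivalence X Y) :
    IsEquivalenceMor e.inv :=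
  .of_isos e.counit.symm e.unit.symm

theorem IsEquivalenceMor.isLeftAdjoint {X Y : M} {f : X ⟶ Y} (h : IsEquivalenceMor f) :
    IsLeftAdjoint f := by
  obtain ⟨e, rfl⟩ := h
  exact .mk ⟨e.unit.hom, e.counit.hom, e.left_triangle_hom, e.right_triangle_hom⟩

theorem isLeftAdjoint_comp {X Y Z : M} {f : X ⟶ Y} {g : Y ⟶ Z} (hf : IsLeftAdjoint f)
    (hg : IsLeftAdjoint g) : IsLeftAdjoint (f ≫ g) :=
  .mk ((Adjunction.ofIsLeftAdjoint f).comp (Adjunction.ofIsLeftAdjoint g))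

theorem isLeftAdjoint_of_iso {X Y : M} {f g : X ⟶ Y} (i : f ≅ g) (hf : IsLeftAdjoint f) :
    IsLeftAdjoint g := by
  let adj := Adjunction.ofIsLeftAdjoint f
  refine .mk (g := rightAdjoint f) ⟨adj.unit ≫ i.hom ▷ _, _ ◁ i.inv ≫ adj.counit, ?_, ?_⟩
  · calc
      _ = 𝟙 _ ⊗≫ adj.unit ▷ g ⊗≫ (i.hom ▷ (rightAdjoint f ≫ g) ≫
            g ◁ rightAdjoint f ◁ i.inv) ⊗≫ g ◁ adj.counit := by
        dsimp only [leftZigzag]; bicategory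
      _ = 𝟙 _ ⊗≫ (adj.unit ▷ g ≫ (f ≫ rightAdjoint f) ◁ i.inv) ⊗≫
            (i.hom ▷ (rightAdjoint f ≫ f) ≫ g ◁ adj.counit) ⊗≫ 𝟙 _ := by
        rw [← whisker_exchange]; bicategory
      _ = 𝟙 _ ⊗≫ i.inv ⊗≫ leftZigzag adj.unit adj.counit ⊗≫ i.hom ⊗≫ 𝟙 _ := by
        rw [← whisker_exchange, ← whisker_exchange]; dsimp only [leftZigzag]; bicategory
      _ = 𝟙 _ ⊗≫ (i.inv ≫ i.hom) ⊗≫ 𝟙 _ := by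
        rw [adj.left_triangle]; bicategory
      _ = _ := by
        rw [i.inv_hom_id]; bicategory
  · calc
      _ = rightAdjoint f ◁ adj.unit ⊗≫ rightAdjoint f ◁ (i.hom ≫ i.inv) ▷ rightAdjoint f ⊗≫
            adj.counit ▷ _ := by
        dsimp only [rightZigzag]; bicategory
      _ = rightZigzag adj.unit adj.counit := by
        rw [i.hom_inv_id]; dsimp only [rightZigzag]; bicategory
      _ = _ := adj.right_triangle

/-- Right liftings are preserved by precomposition with a left adjoint. -/
theorem IsRightLifting.whiskerLeft {J K Y Z : M} {n : Y ⟶ Z} {x : K ⟶ Z} {r : K ⟶ Y}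
    {ϖ : r ≫ n ⟶ x} (h : IsRightLifting n x r ϖ) {l : J ⟶ K} (hl : IsLeftAdjoint l) :
    IsRightLifting n (l ≫ x) (l ≫ r) ((α_ l r n).hom ≫ l ◁ ϖ) := by
  intro v
  let adj := Adjunction.ofIsLeftAdjoint l
  -- Transposition along `l ⊣ rightAdjoint l` turns the map in question into the corresponding map
  -- for `r`, which is bijective by hypothesis.
  have key : ∀ σ : v ⟶ l ≫ r, adj.homEquiv₁ (σ ▷ n ≫ (α_ l r n).hom ≫ l ◁ ϖ) =
      (α_ _ _ _).inv ≫ adj.homEquiv₁ σ ▷ n ≫ ϖ := by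
    intro σ
    simp only [Adjunction.homEquiv₁_apply]
    calc
      _ = 𝟙 _ ⊗≫ rightAdjoint l ◁ σ ▷ n ⊗≫
          ((rightAdjoint l ≫ l) ◁ ϖ ≫ adj.counit ▷ x) ⊗≫ 𝟙 _ := by bicategory
      _ = _ := by rw [whisker_exchange]; bicategory
  have e : (fun σ : v ⟶ l ≫ r => σ ▷ n ≫ (α_ l r n).hom ≫ l ◁ ϖ) =
      fun σ => adj.homEquiv₁.symm ((α_ _ _ _).inv ≫ (adj.homEquiv₁ σ ▷ n ≫ ϖ)) := by
    funext σ
    rw [← key, Equiv.symm_apply_apply]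
  rw [e]
  refine adj.homEquiv₁.symm.bijective.comp (Function.Bijective.comp (g := fun τ =>
    (α_ _ _ _).inv ≫ τ) ?_ ((h _).comp adj.homEquiv₁.bijective))
  exact ⟨fun a b hab => by simpa using hab, fun b => ⟨(α_ _ _ _).hom ≫ b, by simp⟩⟩

/-! ### The terminal object -/

namespace StarTerminal

variable {I : M} (t : StarTerminal I)

/-- The comparison `f ≫ x !_U ⟶ x !_K`. -/
def collapse {K U X : M} (f : K ⟶ U) (x : I ⟶ X) : f ≫ t.bang U ≫ x ⟶ t.bang K ≫ x :=
  (α_ f (t.bang U) x).inv ≫ (t.isTerminal K).from (f ≫ t.bang U) ▷ x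

/-- The source of coherence for `collapse` and `cell`: any two ways of building a 2-cell into `!_K`
agree. -/
theorem hom_ext {K : M} {f : K ⟶ I} (σ τ : f ⟶ t.bang K) : σ = τ :=
  (t.isTerminal K).hom_ext _ _

theorem whiskerRight_collapse {K U X : M} {f g : K ⟶ U} (σ : f ⟶ g) (x : I ⟶ X) :
    σ ▷ (t.bang U ≫ x) ≫ t.collapse g x = t.collapse f x := by
  rw [collapse, collapse,
    t.hom_ext ((t.isTerminal K).from (f ≫ t.bang U))
      (σ ▷ t.bang U ≫ (t.isTerminal K).from (g ≫ t.bang U))]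
  simp [-IsTerminal.comp_from]

theorem collapse_naturality {K U X : M} (f : K ⟶ U) {x y : I ⟶ X} (μ : x ⟶ y) :
    f ◁ t.bang U ◁ μ ≫ t.collapse f y = t.collapse f x ≫ t.bang K ◁ μ := by
  rw [collapse, collapse, Category.assoc, ← whisker_exchange]
  simp

theorem collapse_comp {K V U X : M} (f : K ⟶ V) (g : V ⟶ U) (x : I ⟶ X) :
    t.collapse (f ≫ g) x = (α_ _ _ _).hom ≫ f ◁ t.collapse g x ≫ t.collapse f x := by
  rw [collapse, collapse, collapse,
    t.hom_ext ((t.isTerminal K).from ((f ≫ g) ≫ t.bang U))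
      ((α_ _ _ _).hom ≫ f ◁ (t.isTerminal V).from (g ≫ t.bang U) ≫
        (t.isTerminal K).from (f ≫ t.bang V))]
  simp [-IsTerminal.comp_from]

theorem collapse_id {K X : M} (x : I ⟶ X) : t.collapse (𝟙 K) x = (λ_ _).hom := by
  rw [collapse, t.hom_ext ((t.isTerminal K).from (𝟙 K ≫ t.bang K)) (λ_ _).hom]
  simp

theorem collapse_postcomp {K U X Y : M} (f : K ⟶ U) (x : I ⟶ X) (n : X ⟶ Y) :
    t.collapse f (x ≫ n) =
      f ◁ (α_ _ _ _).inv ≫ (α_ _ _ _).inv ≫ t.collapse f x ▷ n ≫ (α_ _ _ _).hom := by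
  simp [collapse]

theorem nonempty_id_iso : Nonempty (𝟙 I ≅ t.bang I) :=
  t.nonempty_iso I (𝟙 I) (isEquivalenceMor_id I).isLeftAdjoint

/-- A right adjoint `r` of `!_X` gives a terminal object `r !_K` of `M(K, X)`. -/
theorem existsUnique_hom {X : M} {r : I ⟶ X} (adj : t.bang X ⊣ r) {K : M} (f : K ⟶ X) :
    ∃! _ : f ⟶ t.bang K ≫ r, True := by
  refine ⟨adj.homEquiv₂ ((t.isTerminal K).from _), trivial, fun σ _ => ?_⟩
  rw [← Equiv.symm_apply_eq]
  exact t.hom_ext _ _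

/-- The composite `p w ⟶ x !_U w ⟶ x !_K`. -/
def cell {K U X : M} {x : I ⟶ X} {p : U ⟶ X} (ρ : p ⟶ t.bang U ≫ x) (f : K ⟶ U) :
    f ≫ p ⟶ t.bang K ≫ x :=
  f ◁ ρ ≫ t.collapse f x

section cell

variable {K V U X : M} {x : I ⟶ X} {p : U ⟶ X} (ρ : p ⟶ t.bang U ≫ x)

theorem whiskerRight_cell {f g : K ⟶ U} (σ : f ⟶ g) : σ ▷ p ≫ t.cell ρ g = t.cell ρ f := by
  rw [cell, ← whisker_exchange_assoc, whiskerRight_collapse, cell]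

theorem cell_cell (f : K ⟶ V) (g : V ⟶ U) :
    t.cell (t.cell ρ g) f = (α_ _ _ _).inv ≫ t.cell ρ (f ≫ g) := by
  simp [cell, collapse_comp]

theorem cell_id : t.cell ρ (𝟙 U) = (λ_ _).hom ≫ ρ := by
  simp [cell, collapse_id]

theorem cell_precomp {q : U ⟶ X} (i : q ⟶ p) (f : K ⟶ U) :
    t.cell (i ≫ ρ) f = f ◁ i ≫ t.cell ρ f := by
  simp [cell]

theorem cell_postcomp {y : I ⟶ X} (μ : x ⟶ y) (f : K ⟶ U) :
    t.cell (ρ ≫ t.bang U ◁ μ) f = t.cell ρ f ≫ t.bang K ◁ μ := by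
  simp [cell, collapse_naturality]

theorem cell_whiskerRight {Y : M} (n : X ⟶ Y) (f : K ⟶ U) :
    t.cell (ρ ▷ n ≫ (α_ _ _ _).hom) f =
      (α_ _ _ _).inv ≫ t.cell ρ f ▷ n ≫ (α_ _ _ _).hom := by
  simp [cell, collapse_postcomp]

end cell

/-- An elementary form of the universal property of a tabulation. -/
structure Tabulates {U X : M} {x : I ⟶ X} {p : U ⟶ X} (ρ : p ⟶ t.bang U ≫ x) : Prop where
  faithful : ∀ {K : M} {f g : K ⟶ U} {σ τ : f ⟶ g}, σ ▷ p = τ ▷ p → σ = τ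
  full : ∀ {K : M} {f g : K ⟶ U} (θ : f ≫ p ⟶ g ≫ p), θ ≫ t.cell ρ g = t.cell ρ f →
    ∃ σ : f ⟶ g, σ ▷ p = θ
  exists_lift : ∀ {K : M} (g : K ⟶ X) (γ : g ⟶ t.bang K ≫ x),
    ∃ (f : K ⟶ U) (i : f ≫ p ≅ g), i.hom ≫ γ = t.cell ρ f

/-- The right leg of the comma category has a one-point domain, so an object is just a 2-cell `g ⟶ x
!_K` and a morphism is a 2-cell over `x !_K`. -/
theorem tabulates_iff {U X : M} {x : I ⟶ X} {p : U ⟶ X} (ρ : p ⟶ t.bang U ≫ x) :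
    t.Tabulates ρ ↔ ∀ K : M, (tabFunctor t ρ K).IsEquivalence := by
  constructor
  · intro h K
    refine { faithful := ⟨fun {f g σ τ} e => ?_⟩, full := ⟨fun {f g} θ => ?_⟩,
             essSurj := ⟨fun c => ?_⟩ }
    · exact h.faithful (congrArg CommaMorphism.left e)
    · obtain ⟨σ, hσ⟩ := h.full θ.left (θ.w.trans (Category.comp_id _))
      exact ⟨σ, CommaMorphism.ext hσ (Subsingleton.elim _ _)⟩
    · obtain ⟨f, i, hi⟩ := h.exists_lift c.left c.hom
      exact ⟨f, ⟨Comma.isoMk i (Iso.refl _) (hi.trans (Category.comp_id _).symm)⟩⟩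
  · intro h
    refine ⟨fun {K f g σ τ} e => ?_, fun {K f g} θ e => ?_, fun {K} g γ => ?_⟩
    · exact (tabFunctor t ρ K).map_injective (CommaMorphism.ext e rfl)
    · obtain ⟨σ, hσ⟩ := (tabFunctor t ρ K).map_surjective (X := f) (Y := g)
        ⟨θ, 𝟙 _, e.trans (Category.comp_id _).symm⟩
      exact ⟨σ, congrArg CommaMorphism.left hσ⟩
    · let c : Comma (𝟭 (K ⟶ X)) (Functor.fromPUnit.{0} (t.bang K ≫ x)) := ⟨g, ⟨⟨⟩⟩, γ⟩
      let i := (tabFunctor t ρ K).objObjPreimageIso c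
      exact ⟨_, Comma.leftIso i, i.hom.w.trans (Category.comp_id _)⟩

end StarTerminal

theorem IsEquivalenceMor.isEquivalence_postcomp {X Y : M} {f : X ⟶ Y} (h : IsEquivalenceMor f)
    (K : M) : (postcomp K f).IsEquivalence := by
  obtain ⟨e, rfl⟩ := h
  exact (CategoryTheory.Equivalence.mk (postcomp K e.hom) (postcomp K e.inv)
    (NatIso.ofComponents (fun f => (ρ_ f).symm ≪≫ whiskerLeftIso f e.unit ≪≫ (α_ _ _ _).symm)
      (fun σ => by
        change σ ≫ (ρ_ _).inv ≫ _ ◁ e.unit.hom ≫ (α_ _ _ _).inv =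
          ((ρ_ _).inv ≫ _ ◁ e.unit.hom ≫ (α_ _ _ _).inv) ≫ σ ▷ e.hom ▷ e.inv
        rw [rightUnitor_inv_naturality_assoc, ← whisker_exchange_assoc]
        simp))
    (NatIso.ofComponents (fun f => α_ _ _ _ ≪≫ whiskerLeftIso f e.counit ≪≫ ρ_ f)
      (fun σ => by
        change σ ▷ e.inv ▷ e.hom ≫ (α_ _ _ _).hom ≫ _ ◁ e.counit.hom ≫ (ρ_ _).hom =
          ((α_ _ _ _).hom ≫ _ ◁ e.counit.hom ≫ (ρ_ _).hom) ≫ σ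
        rw [associator_naturality_left_assoc, ← whisker_exchange_assoc]
        simp))).isEquivalence_functor

/-! ### Invariance of tabulations under isomorphism, equivalence and change of terminal object. -/

namespace StarTerminal

variable {I : M} (t : StarTerminal I)

namespace Tabulates

variable {t}

section

variable {U X : M} {x : I ⟶ X} {p : U ⟶ X} {ρ : p ⟶ t.bang U ≫ x}

theorem exists_iso (h : t.Tabulates ρ) {K : M} {f g : K ⟶ U} (θ : f ≫ p ≅ g ≫ p)
    (hθ : θ.hom ≫ t.cell ρ g = t.cell ρ f) : ∃ σ : f ≅ g, σ.hom ▷ p = θ.hom := by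
  obtain ⟨σ, hσ⟩ := h.full θ.hom hθ
  obtain ⟨τ, hτ⟩ := h.full θ.inv (by rw [← hθ, Iso.inv_hom_id_assoc])
  exact ⟨⟨σ, τ, h.faithful (by simp [hσ, hτ]), h.faithful (by simp [hσ, hτ])⟩, hσ⟩

/-- The universal property sees `ρ` only through its cells, so the objects `x !_K` may be replaced
by isomorphic ones, even over another terminal object. -/
theorem of_cell_eq (h : t.Tabulates ρ) {I' : M} {t' : StarTerminal I'} {x' : I' ⟶ X}
    {ρ' : p ⟶ t'.bang U ≫ x'} (ψ : ∀ K, t.bang K ≫ x ≅ t'.bang K ≫ x')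
    (hψ : ∀ {K : M} (f : K ⟶ U), t'.cell ρ' f = t.cell ρ f ≫ (ψ K).hom) : t'.Tabulates ρ' where
  faithful := h.faithful
  full θ hθ := h.full θ (by
    rw [hψ, hψ, ← Category.assoc, cancel_mono] at hθ
    exact hθ)
  exists_lift {K} g γ := by
    obtain ⟨f, i, hi⟩ := h.exists_lift g (γ ≫ (ψ K).inv)
    refine ⟨f, i, ?_⟩
    rw [hψ, ← hi]
    simp

/-- `Tab` allows any choice of terminal object; this reduces it to a fixed one. Two left adjoints
into `I` with the same domain are isomorphic, which supplies the isomorphisms `e`. -/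
theorem exists_change (h : t.Tabulates ρ) {I' : M} (t' : StarTerminal I') :
    ∃ ρ' : p ⟶ t'.bang U ≫ t.bang I' ≫ x, t'.Tabulates ρ' := by
  let e (K : M) : t'.bang K ≫ t.bang I' ≅ t.bang K := (t.nonempty_iso K _
    (isLeftAdjoint_comp (t'.isLeftAdjoint_bang K) (t.isLeftAdjoint_bang I'))).some
  let ψ (K : M) : t.bang K ≫ x ≅ t'.bang K ≫ t.bang I' ≫ x :=
    whiskerRightIso (e K).symm x ≪≫ α_ _ _ _
  refine ⟨ρ ≫ (ψ U).hom, h.of_cell_eq ψ fun {K} f => ?_⟩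
  have key : (t.isTerminal K).from (f ≫ t.bang U) = f ◁ (e U).inv ≫ (α_ _ _ _).inv ≫
      (t'.isTerminal K).from (f ≫ t'.bang U) ▷ t.bang I' ≫ (e K).hom := t.hom_ext _ _
  simp only [cell, collapse, ψ, key, Iso.trans_hom, whiskerRightIso_hom, Iso.symm_hom,
    comp_whiskerRight, Category.assoc, hom_inv_whiskerRight_assoc]
  simp

theorem of_iso (h : t.Tabulates ρ) {q : U ⟶ X} (i : q ≅ p) : t.Tabulates (i.hom ≫ ρ) where
  faithful {K f g σ τ} e := h.faithful (by
    rw [← cancel_epi (f ◁ i.hom), whisker_exchange, whisker_exchange, e])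
  full {K f g} θ hθ := by
    rw [cell_precomp, cell_precomp] at hθ
    obtain ⟨σ, hσ⟩ := h.full (f ◁ i.inv ≫ θ ≫ g ◁ i.hom) (by simp [hθ])
    refine ⟨σ, ?_⟩
    rw [← cancel_mono (g ◁ i.hom), ← whisker_exchange, hσ]
    simp
  exists_lift g γ := by
    obtain ⟨f, j, hj⟩ := h.exists_lift g γ
    exact ⟨f, whiskerLeftIso f i ≪≫ j, by simp [cell_precomp, hj]⟩

theorem precomp (h : t.Tabulates ρ) {V : M} {e : V ⟶ U} (he : IsEquivalenceMor e) :
    t.Tabulates (t.cell ρ e) where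
  faithful {K f g σ τ} eq := by
    have := he.isEquivalence_postcomp K
    have h' : σ ▷ e ▷ p = τ ▷ e ▷ p := by simpa using eq
    exact (postcomp K e).map_injective (h.faithful h')
  full {K f g} θ hθ := by
    have := he.isEquivalence_postcomp K
    rw [cell_cell, cell_cell] at hθ
    obtain ⟨σ, hσ⟩ := h.full ((α_ _ _ _).hom ≫ θ ≫ (α_ _ _ _).inv) (by simp [hθ])
    obtain ⟨τ, rfl⟩ := (postcomp K e).map_surjective σ
    refine ⟨τ, ?_⟩
    change τ ▷ e ▷ p = _ at hσ
    rw [whiskerRight_comp, hσ]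
    simp
  exists_lift {K} g γ := by
    have := he.isEquivalence_postcomp K
    obtain ⟨f, i, hi⟩ := h.exists_lift g γ
    let j : (postcomp K e).objPreimage f ≫ e ≅ f := (postcomp K e).objObjPreimageIso f
    refine ⟨(postcomp K e).objPreimage f, (α_ _ _ _).symm ≪≫ whiskerRightIso j p ≪≫ i, ?_⟩
    simp [hi, cell_cell, whiskerRight_cell]

end

/-! ### Uniqueness of tabulations. -/

section Uniqueness

variable {E F X : M} {x : I ⟶ X} {m : E ⟶ X} {p : F ⟶ X} {ρ : m ⟶ t.bang E ≫ x}
  {ρ' : p ⟶ t.bang F ≫ x}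

/-- Both `𝟙 F` and `f ≫ g` are lifts of the object `(p, ρ')` of the slice over `x !_F`. -/
theorem nonempty_id_iso_comp (h' : t.Tabulates ρ') {f : F ⟶ E} {g : E ⟶ F} (i : f ≫ m ≅ p)
    (hi : i.hom ≫ ρ' = t.cell ρ f) (j : g ≫ p ≅ m) (hj : j.hom ≫ ρ = t.cell ρ' g) :
    Nonempty (𝟙 F ≅ f ≫ g) := by
  obtain ⟨σ, -⟩ := h'.exists_iso (f := 𝟙 F) (g := f ≫ g)
    (λ_ p ≪≫ i.symm ≪≫ whiskerLeftIso f j.symm ≪≫ (α_ _ _ _).symm) (by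
      have : t.cell ρ' (f ≫ g) = (α_ _ _ _).hom ≫ f ◁ j.hom ≫ i.hom ≫ ρ' := by
        rw [hi, ← cell_precomp, hj, cell_cell, Iso.hom_inv_id_assoc]
      rw [this, cell_id]
      simp)
  exact ⟨σ⟩

/-- The domain of a tabulation is unique up to equivalence. -/
theorem exists_equivalence (h : t.Tabulates ρ) (h' : t.Tabulates ρ') :
    ∃ f : F ⟶ E, IsEquivalenceMor f ∧ Nonempty (f ≫ m ≅ p) := by
  obtain ⟨f, i, hi⟩ := h.exists_lift p ρ'
  obtain ⟨g, j, hj⟩ := h'.exists_lift m ρ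
  obtain ⟨η⟩ := h'.nonempty_id_iso_comp i hi j hj
  obtain ⟨η'⟩ := h.nonempty_id_iso_comp j hj i hi
  exact ⟨f, .of_isos η η'.symm, ⟨i⟩⟩

end Uniqueness

/-! ### Composition and cancellation of tabulations. -/

section Composition

variable {X Y Z : M} {q : X ⟶ Y} {p : Y ⟶ Z} {x : I ⟶ Z} {ρ : p ⟶ t.bang Y ≫ x}

theorem comp (hp : t.Tabulates ρ) {y : I ⟶ Y} {ρ' : q ⟶ t.bang X ≫ y} (hq : t.Tabulates ρ') :
    t.Tabulates (ρ' ▷ p ≫ (α_ _ _ _).hom) where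
  faithful {K f g σ τ} e := by
    refine hq.faithful (hp.faithful ?_)
    simpa using e
  full {K f g} θ hθ := by
    simp only [cell_whiskerRight] at hθ
    have h₁ : ((α_ _ _ _).hom ≫ θ ≫ (α_ _ _ _).inv) ≫ t.cell ρ' g ▷ p = t.cell ρ' f ▷ p := by
      rw [← cancel_mono (α_ _ _ _).hom, ← cancel_epi (α_ _ _ _).inv]
      simpa using hθ
    obtain ⟨σ, hσ⟩ := hp.full ((α_ _ _ _).hom ≫ θ ≫ (α_ _ _ _).inv) (by
      rw [← t.whiskerRight_cell ρ (t.cell ρ' g), ← Category.assoc, h₁, whiskerRight_cell])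
    obtain ⟨τ, rfl⟩ := hq.full σ (hp.faithful (by rw [comp_whiskerRight, hσ, h₁]))
    refine ⟨τ, ?_⟩
    rw [whiskerRight_comp, hσ]
    simp
  exists_lift {K} g γ := by
    -- Composing `γ` with the cell of `y !_K` places `g` over `x !_K`. It then lifts to `s`, and
    -- `γ`, now a morphism of that slice, lifts to `σ : s ⟶ y !_K`.
    obtain ⟨s, i, hi⟩ := hp.exists_lift g (γ ≫ (α_ _ _ _).inv ≫ t.cell ρ (t.bang K ≫ y))
    obtain ⟨σ, hσ⟩ := hp.full (i.hom ≫ γ ≫ (α_ _ _ _).inv) (by simp [hi])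
    obtain ⟨f, j, hj⟩ := hq.exists_lift s σ
    refine ⟨f, (α_ _ _ _).symm ≪≫ whiskerRightIso j p ≪≫ i, ?_⟩
    rw [cell_whiskerRight, ← hj, comp_whiskerRight, hσ]
    simp

end Composition

end Tabulates

/-- The isomorphism `x ≅ x !_I`, as a morphism. -/
def toBang {X : M} (x : I ⟶ X) : x ⟶ t.bang I ≫ x :=
  (λ_ x).inv ≫ (t.isTerminal I).from (𝟙 I) ▷ x

theorem isIso_toBang {X : M} (x : I ⟶ X) : IsIso (t.toBang x) := by
  obtain ⟨e⟩ := t.nonempty_id_iso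
  have : (t.isTerminal I).from (𝟙 I) = e.hom := t.hom_ext _ _
  rw [toBang, this]
  infer_instance

theorem whiskerLeft_toBang {K X : M} (x : I ⟶ X) :
    t.bang K ◁ t.toBang x ≫ t.collapse (t.bang K) x = 𝟙 _ := by
  have : (ρ_ (t.bang K)).inv ≫ t.bang K ◁ (t.isTerminal I).from (𝟙 I) ≫
      (t.isTerminal K).from (t.bang K ≫ t.bang I) = 𝟙 _ := t.hom_ext _ _
  have h := congrArg (· ▷ x) this
  simp only [comp_whiskerRight, id_whiskerRight] at h
  rw [← h]
  simp [toBang, collapse, -IsTerminal.comp_from]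

/-- Up to `x ≅ x !_I`, the transpose of `ρ` is the object of the slice over `x !_I` that corresponds
to `r`. -/
theorem counit_toBang {U X : M} {x : I ⟶ X} {m : U ⟶ X} (ρ : m ⟶ t.bang U ≫ x)
    {r : I ⟶ U} (adj : t.bang U ⊣ r) :
    adj.homEquiv₁ ρ ≫ t.toBang x = t.cell ρ r := by
  rw [cell, collapse, t.hom_ext ((t.isTerminal I).from (r ≫ t.bang U))
    (adj.counit ≫ (t.isTerminal I).from (𝟙 I))]
  simp [toBang, Adjunction.homEquiv₁_apply, -IsTerminal.comp_from]

/-- A tabulation `ρ : m ⟶ z !_U` exhibits `z` as a left extension of `m` along `!_U`. -/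
theorem Tabulates.exists_desc {t : StarTerminal I} {U X : M} {z : I ⟶ X} {m : U ⟶ X}
    {ρ : m ⟶ t.bang U ≫ z} (h : t.Tabulates ρ) {x : I ⟶ X} (κ : m ⟶ t.bang U ≫ x) :
    ∃ μ : z ⟶ x, ρ ≫ t.bang U ◁ μ = κ := by
  have hU := t.isLeftAdjoint_bang U
  let adj := Adjunction.ofIsLeftAdjoint (t.bang U)
  have := t.isIso_toBang z
  have h₁ := t.isIso_toBang (rightAdjoint (t.bang U))
  have hr {v : I ⟶ U} (σ τ : v ⟶ rightAdjoint (t.bang U)) : σ = τ := by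
    rw [← cancel_mono (t.toBang _)]
    exact (t.existsUnique_hom adj v).unique trivial trivial
  -- The lift `e` corresponds to `z ≅ z !_I`, a terminal object of the slice, while the right
  -- adjoint of `!_U` is terminal in `M(I, U)`. Hence `σ` below is invertible, and so is the
  -- transpose of `ρ`.
  obtain ⟨e, i, hi⟩ := h.exists_lift z (t.toBang z)
  have : IsIso (t.cell ρ e) := by rw [← hi]; infer_instance
  obtain ⟨σ, hσ⟩ := h.full (f := rightAdjoint (t.bang U)) (adj.homEquiv₁ ρ ≫ i.inv) (by
    rw [← hi, ← counit_toBang t ρ adj]; simp)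
  obtain ⟨τ, -⟩ := (t.existsUnique_hom adj e).exists
  have hτ : IsIso σ := by
    refine ⟨τ ≫ inv (t.toBang _), hr _ _, h.faithful ?_⟩
    rw [← cancel_mono (t.cell ρ e), whiskerRight_cell, whiskerRight_cell]
  have : IsIso (adj.homEquiv₁ ρ) := by
    rw [show adj.homEquiv₁ ρ = σ ▷ m ≫ i.hom by rw [hσ]; simp]
    infer_instance
  -- After transposition the equation for `μ` is `adj.homEquiv₁ ρ ≫ μ = adj.homEquiv₁ κ`.
  refine ⟨inv (adj.homEquiv₁ ρ) ≫ adj.homEquiv₁ κ, adj.homEquiv₁.injective ?_⟩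
  have key (μ : z ⟶ x) : adj.homEquiv₁ (ρ ≫ t.bang U ◁ μ) = adj.homEquiv₁ ρ ≫ μ := by
    simp only [Adjunction.homEquiv₁_apply]
    calc
      _ = 𝟙 _ ⊗≫ rightAdjoint (t.bang U) ◁ ρ ⊗≫
          ((rightAdjoint (t.bang U) ≫ t.bang U) ◁ μ ≫ adj.counit ▷ x) ⊗≫ 𝟙 _ := by bicategory
      _ = _ := by rw [whisker_exchange]; bicategory
  rw [key, IsIso.hom_inv_id_assoc]

/-- The left extension property gives `μ : z ⟶ x`, so `z` lifts through `p` to some `y` with `y ≫ p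
≅ z`, and `ρ'` lifts to `τ`. The universal property of `τ` is that of `ρ'` read inside the slice
over `x !_K`. -/
theorem Tabulates.of_comp {t : StarTerminal I} {X Y Z : M} {q : X ⟶ Y} {p : Y ⟶ Z} {x z : I ⟶ Z}
    {ρ : p ⟶ t.bang Y ≫ x} (hp : t.Tabulates ρ) {ρ' : q ≫ p ⟶ t.bang X ≫ z}
    (h : t.Tabulates ρ') : ∃ (y : I ⟶ Y) (τ : q ⟶ t.bang X ≫ y), t.Tabulates τ := by
  obtain ⟨μ, hμ⟩ := h.exists_desc (t.cell ρ q)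
  obtain ⟨y, i, hi⟩ := hp.exists_lift z (μ ≫ t.toBang x)
  -- Up to `y ≫ p ≅ z`, the structure map of `y !_K` over `x !_K` is `μ !_K`.
  have hy (K : M) : t.cell ρ (t.bang K ≫ y) =
      (α_ _ _ _).hom ≫ t.bang K ◁ i.hom ≫ t.bang K ◁ μ := by
    have := t.cell_cell ρ (t.bang K) y
    rw [Iso.eq_inv_comp, ← hi] at this
    rw [← this, cell]
    simp [whiskerLeft_toBang]
  obtain ⟨τ, hτ⟩ := hp.full (ρ' ≫ t.bang X ◁ i.inv ≫ (α_ _ _ _).inv) (by rw [hy]; simp [hμ])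
  have hρ : ρ' = (τ ▷ p ≫ (α_ _ _ _).hom) ≫ t.bang X ◁ i.hom := by rw [hτ]; simp
  have hc {K : M} (f : K ⟶ X) : t.cell ρ' f =
      (α_ _ _ _).inv ≫ t.cell τ f ▷ p ≫ (α_ _ _ _).hom ≫ t.bang K ◁ i.hom := by
    rw [hρ, cell_postcomp, cell_whiskerRight]; simp
  refine ⟨y, τ, ?_, ?_, ?_⟩
  · intro K f g σ τ e
    refine h.faithful ?_
    rw [whiskerRight_comp, whiskerRight_comp, e]
  · intro K f g θ hθ
    obtain ⟨σ, hσ⟩ := h.full ((α_ _ _ _).inv ≫ θ ▷ p ≫ (α_ _ _ _).hom) (by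
      rw [hc, hc, ← hθ]; simp)
    refine ⟨σ, hp.faithful ?_⟩
    rw [← cancel_epi (α_ _ _ _).inv, ← cancel_mono (α_ _ _ _).hom, Category.assoc,
      Category.assoc, ← hσ, whiskerRight_comp]
  · intro K s γ
    obtain ⟨f, k, hk⟩ := h.exists_lift (s ≫ p) (γ ▷ p ≫ (α_ _ _ _).hom ≫ t.bang K ◁ i.hom)
    -- `f ≫ q` and `s` have isomorphic images in the slice over `x !_K`, hence are isomorphic.
    obtain ⟨j, hj⟩ := hp.exists_iso (f := f ≫ q) (g := s) (α_ _ _ _ ≪≫ k) (by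
      rw [← t.whiskerRight_cell ρ γ, hy]
      have := congrArg (fun a => (α_ _ _ _).hom ≫ a ≫ t.bang K ◁ μ) hk
      simp only [Category.assoc] at this
      rw [Iso.trans_hom, Category.assoc, this, ← cell_postcomp, hμ, cell_cell]
      simp)
    refine ⟨f, j, hp.faithful ?_⟩
    rw [hc] at hk
    rw [comp_whiskerRight, hj, ← cancel_mono ((α_ _ _ _).hom ≫ t.bang K ◁ i.hom),
      ← cancel_epi (α_ _ _ _).inv]
    simpa using hk

/-- The identity is tabulated. -/
theorem exists_tabulates_id (X : M) :
    ∃ (x : I ⟶ X) (ρ : 𝟙 X ⟶ t.bang X ≫ x), t.Tabulates ρ := by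
  have hX := t.isLeftAdjoint_bang X
  let adj := Adjunction.ofIsLeftAdjoint (t.bang X)
  obtain ⟨ρ, -⟩ := (t.existsUnique_hom adj (𝟙 X)).exists
  -- With this choice of `x`, `x !_K` is terminal, and the slice over a terminal object is the whole
  -- category.
  refine ⟨rightAdjoint (t.bang X), ρ, ?_, ?_, ?_⟩
  · intro K f g σ τ e
    simpa using e
  · intro K f g θ _
    exact ⟨(ρ_ f).inv ≫ θ ≫ (ρ_ g).hom, by simp⟩
  · intro K g γ
    exact ⟨g, ρ_ g, (t.existsUnique_hom adj _).unique trivial trivial⟩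

end StarTerminal

/-! ### The calibration axioms for tabulations. -/

namespace StarTerminal

variable {I : M} {t : StarTerminal I}

/-- In a slice, the structure map of a domain is forced by that of the codomain: `β` lifts by
composing with the cell of `e`, and a factorization downstairs is automatically a morphism over `x
!_K`. -/
theorem Tabulates.isGroupoidFibration {E B : M} {x : I ⟶ B} {p : E ⟶ B} {ρ : p ⟶ t.bang E ≫ x}
    (h : t.Tabulates ρ) : IsGroupoidFibration p := by
  refine fun K => ⟨fun e b β => ?_, fun {e' e} χ => ?_⟩
  · change b ⟶ e ≫ p at β
    obtain ⟨f, i, hi⟩ := h.exists_lift b (β ≫ t.cell ρ e)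
    obtain ⟨χ, hχ⟩ := h.full (i.hom ≫ β) (by simpa using hi)
    refine ⟨f, χ, i.symm, ?_⟩
    change i.inv ≫ χ ▷ p = β
    rw [hχ, Iso.inv_hom_id_assoc]
  · refine { universal_property' := fun {a} g φ hφ => ?_ }
    obtain ⟨g', hg'⟩ : ∃ g' : a ≫ p ⟶ e' ≫ p, g' = g := ⟨g, rfl⟩
    have hφ' : g' ≫ χ ▷ p = φ ▷ p := by
      rw [hg']
      exact IsHomLift.eq_of_isHomLift (postcomp K p) (g ≫ (postcomp K p).map χ) φ
    obtain ⟨ψ, hψ⟩ := h.full g' (by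
      rw [← t.whiskerRight_cell ρ χ, ← Category.assoc, hφ', whiskerRight_cell])
    have hψ' : (postcomp K p).map ψ = g := hψ.trans hg'
    refine ⟨ψ, ⟨hψ' ▸ IsHomLift.map _ ψ, h.faithful ?_⟩, fun ψ' hψ'' => h.faithful ?_⟩
    · rw [comp_whiskerRight, hψ, hφ']
    · have := hψ''.1
      exact (IsHomLift.eq_of_isHomLift (postcomp K p) g ψ').symm.trans hψ'.symm

/-- Pulling back a tabulation of `x` along `n` amounts to tabulating a right lifting of `x`
through `n`. -/
theorem Tabulates.exists_isBipullback {S T Y P : M} {x : I ⟶ Y} {p : S ⟶ Y}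
    {ρ : p ⟶ t.bang S ≫ x} (hp : t.Tabulates ρ) {n : T ⟶ Y} {r : I ⟶ T} {ϖ : r ≫ n ⟶ x}
    (hr : IsRightLifting n x r ϖ) {p' : P ⟶ T} {ρ' : p' ⟶ t.bang P ≫ r}
    (hp' : t.Tabulates ρ') :
    ∃ (n' : P ⟶ S) (θ : p' ≫ n ≅ n' ≫ p), IsBipullback θ := by
  let ν (K : M) : (t.bang K ≫ r) ≫ n ⟶ t.bang K ≫ x := (α_ _ _ _).hom ≫ t.bang K ◁ ϖ
  have hν (K : M) : IsRightLifting n (t.bang K ≫ x) (t.bang K ≫ r) (ν K) :=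
    hr.whiskerLeft (t.isLeftAdjoint_bang K)
  obtain ⟨n', i, hi⟩ := hp.exists_lift (p' ≫ n) (ρ' ▷ n ≫ ν P)
  refine ⟨n', i.symm, fun K => ?_⟩
  let Θ (f : K ⟶ P) : (f ≫ p') ≫ n ≅ (f ≫ n') ≫ p :=
    α_ f p' n ≪≫ whiskerLeftIso f i.symm ≪≫ (α_ f n' p).symm
  -- The object of the slice over `x !_K` given by `f ≫ n'` is the transpose, under the right
  -- lifting, of the 2-cell to `r !_K` given by `f ≫ p'`.
  have key (f : K ⟶ P) : (Θ f).hom ≫ t.cell ρ (f ≫ n') = t.cell ρ' f ▷ n ≫ ν K := by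
    have h₁ := t.cell_cell ρ f n'
    rw [Iso.eq_inv_comp, ← hi, ← Category.assoc (ρ' ▷ n), cell_precomp, cell_postcomp,
      cell_whiskerRight] at h₁
    rw [← h₁]
    simp [Θ, ν]
  refine { faithful := ⟨fun {f g σ τ} e => hp'.faithful (congrArg CategoricalPullback.Hom.fst e)⟩,
           full := ⟨fun {f g} a => ?_⟩, essSurj := ⟨fun c => ?_⟩ }
  · obtain ⟨a, b, ha⟩ := a
    change f ≫ p' ⟶ g ≫ p' at a
    change f ≫ n' ⟶ g ≫ n' at b
    change a ▷ n ≫ (Θ g).hom = (Θ f).hom ≫ b ▷ p at ha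
    obtain ⟨σ, rfl⟩ := hp'.full a ((hν K _).injective (by
      rw [comp_whiskerRight, Category.assoc, ← key, ← key, ← Category.assoc, ha,
        Category.assoc, whiskerRight_cell]))
    refine ⟨σ, CategoricalPullback.hom_ext rfl (hp.faithful ?_)⟩
    have hs : σ ▷ p' ▷ n ≫ (Θ g).hom = (Θ f).hom ≫ σ ▷ n' ▷ p :=
      ((squareFunctor i.symm K).map σ).w
    rw [ha] at hs
    exact ((cancel_epi _).1 hs).symm
  · obtain ⟨a, b, c⟩ := c
    change a ≫ n ≅ b ≫ p at c
    -- `b` provides a 2-cell `a ≫ n ⟶ x !_K`. Its transpose `a ⟶ r !_K` lifts to `f`, and `f ≫ n' ≅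
    -- b` because both lie over the same object of the slice.
    obtain ⟨s, hs⟩ := (hν K a).surjective (c.hom ≫ t.cell ρ b)
    change s ▷ n ≫ ν K = _ at hs
    obtain ⟨f, k, hk⟩ := hp'.exists_lift a s
    obtain ⟨j, hj⟩ := hp.exists_iso ((Θ f).symm ≪≫ whiskerRightIso k n ≪≫ c) (by
      rw [Iso.trans_hom, Iso.trans_hom, Category.assoc, Category.assoc, ← hs, Iso.symm_hom,
        Iso.inv_comp_eq, key, ← hk, comp_whiskerRight, Category.assoc, whiskerRightIso_hom])
    refine ⟨f, ⟨CategoricalPullback.mkIso k j ?_⟩⟩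
    change k.hom ▷ n ≫ c.hom = (Θ f).hom ≫ j.hom ▷ p
    simp [hj]

theorem tab_iff (t : StarTerminal I) {U X : M} (p : U ⟶ X) :
    Tab p ↔ IsLeftAdjoint p ∧ ∃ (x : I ⟶ X) (ρ : p ⟶ t.bang U ≫ x), t.Tabulates ρ := by
  constructor
  · rintro ⟨J, t', x, ρ, h⟩
    exact ⟨h.isLeftAdjoint, _, ((t'.tabulates_iff ρ).2 h.isEquivalence).exists_change t⟩
  · rintro ⟨hp, x, ρ, h⟩
    exact ⟨I, t, x, ρ, hp, (t.tabulates_iff ρ).1 h⟩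

theorem tab_of_iso (t : StarTerminal I) {U X : M} {p q : U ⟶ X} (hp : Tab p) (i : p ≅ q) :
    Tab q := by
  obtain ⟨hl, x, ρ, h⟩ := (t.tab_iff p).1 hp
  exact (t.tab_iff q).2 ⟨isLeftAdjoint_of_iso i hl, x, _, h.of_iso i.symm⟩

theorem tab_precomp (t : StarTerminal I) {V U X : M} {e : V ⟶ U} (he : IsEquivalenceMor e)
    {p : U ⟶ X} (hp : Tab p) : Tab (e ≫ p) := by
  obtain ⟨hl, x, ρ, h⟩ := (t.tab_iff p).1 hp
  exact (t.tab_iff _).2 ⟨isLeftAdjoint_comp he.isLeftAdjoint hl, x, _, h.precomp he⟩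

/-- If all morphisms out of the terminal object have tabulations, then tabulations form a
calibration. -/
theorem isCalibration_tab (t : StarTerminal I)
    (htab : ∀ {X : M} (x : I ⟶ X), ∃ (U : M) (p : U ⟶ X) (ρ : p ⟶ t.bang U ≫ x),
      IsLeftAdjoint p ∧ t.Tabulates ρ) : IsCalibration (M := M) Tab where
  of_equivalence {X Y} f hf := by
    obtain ⟨x, ρ, h⟩ := t.exists_tabulates_id Y
    exact t.tab_of_iso (t.tab_precomp hf
      ((t.tab_iff _).2 ⟨(isEquivalenceMor_id Y).isLeftAdjoint, x, ρ, h⟩)) (ρ_ f)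
  of_iso p q hp i := t.tab_of_iso hp i
  comp_iff {X Y Z} q p hp := by
    obtain ⟨hl, x, ρ, h⟩ := (t.tab_iff p).1 hp
    constructor
    · intro hqp
      obtain ⟨-, z, ρ', h'⟩ := (t.tab_iff _).1 hqp
      obtain ⟨y, τ, hτ⟩ := h.of_comp h'
      -- Cancellation does not show that `q` is a left adjoint; this follows by comparison with a
      -- tabulation of `y` by a left adjoint.
      obtain ⟨U, q', ρ'', hl', h''⟩ := htab y
      obtain ⟨e, he, ⟨i⟩⟩ := h''.exists_equivalence hτ
      exact (t.tab_iff q).2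
        ⟨isLeftAdjoint_of_iso i (isLeftAdjoint_comp he.isLeftAdjoint hl'), y, τ, hτ⟩
    · intro hq
      obtain ⟨hl', y, τ, hτ⟩ := (t.tab_iff q).1 hq
      exact (t.tab_iff _).2 ⟨isLeftAdjoint_comp hl' hl, _, _, h.comp hτ⟩
  groupoidFibration p hp := by
    obtain ⟨-, x, ρ, h⟩ := (t.tab_iff p).1 hp
    exact h.isGroupoidFibration
  exists_bipullback {S T Y} p n hp hn := by
    obtain ⟨-, x, ρ, h⟩ := (t.tab_iff p).1 hp
    obtain ⟨r, ϖ, hr⟩ := hn I x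
    obtain ⟨P, p', ρ', hl', h'⟩ := htab r
    obtain ⟨n', θ, hθ⟩ := h.exists_isBipullback hr h'
    exact ⟨P, p', n', θ, hθ, (t.tab_iff p').2 ⟨hl', r, ρ', h'⟩⟩

end StarTerminal
end BicatNotions

/-! ### Composition with `p_*` for the category of elements of a presheaf. -/

namespace ModBicat

open Opposite

theorem map_op_comp_apply {B : Type u} [SmallCategory B] (W : Bᵒᵖ ⥤ Type u) {a b c : B}
    (f : a ⟶ b) (g : b ⟶ c) (x : W.obj (op c)) :
    W.map (f ≫ g).op x = W.map f.op (W.map g.op x) := by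
  simp

theorem map_inv_op_apply_eq_iff {B : Type u} [SmallCategory B] (W : Bᵒᵖ ⥤ Type u) {a b : B}
    (j : a ≅ b) (x : W.obj (op a)) (y : W.obj (op b)) :
    W.map j.inv.op x = y ↔ x = W.map j.hom.op y := by
  constructor
  · rintro rfl
    simp [← map_op_comp_apply]
  · rintro rfl
    simp [← map_op_comp_apply]

theorem isIso_of_bijective {A B : Type u} [SmallCategory A] [SmallCategory B]
    {P Q : Profunctor.{u} A B} (η : P ⟶ Q)
    (h : ∀ (a : A) (b : B), Function.Bijective ((η.app a).app (op b))) : IsIso η := by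
  rw [NatTrans.isIso_iff_isIso_app]
  intro a
  rw [NatTrans.isIso_iff_isIso_app]
  intro b
  exact (isIso_iff_bijective _).2 (h a b.unop)

section Lower

variable {K F B : Type u} [SmallCategory K] [SmallCategory F] [SmallCategory B] (p : F ⥤ B)

/-- The class of `(a, β)` in `∫^e f(e, k) × B(b, p e)`. -/
def lmk (f : Profunctor.{u} K F) (k : K) {b : B} {e : F} (a : (f.obj k).obj (op e))
    (β : b ⟶ p.obj e) : ((comp f p.toProfunctor).obj k).obj (op b) :=
  tmk f p.toProfunctor k (op b) e a β

variable {p} {f g : Profunctor.{u} K F} {k : K}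

theorem lmk_glide {b : B} {e e' : F} (χ : e ⟶ e') (a : (f.obj k).obj (op e'))
    (β : b ⟶ p.obj e) :
    lmk p f k ((f.obj k).map χ.op a) β = lmk p f k a (β ≫ p.map χ) :=
  tmk_glide f p.toProfunctor k (op b) χ a β

theorem lmk_ind {b : B} {motive : ((comp f p.toProfunctor).obj k).obj (op b) → Prop}
    (h : ∀ (e : F) (a : (f.obj k).obj (op e)) (β : b ⟶ p.obj e), motive (lmk p f k a β))
    (t : ((comp f p.toProfunctor).obj k).obj (op b)) : motive t :=
  tensor_ind h t

theorem map_lmk {b b' : B} (γ : b' ⟶ b) {e : F} (a : (f.obj k).obj (op e)) (β : b ⟶ p.obj e) :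
    ((comp f p.toProfunctor).obj k).map γ.op (lmk p f k a β) = lmk p f k a (γ ≫ β) :=
  rfl

theorem map_app_lmk {k' : K} (κ : k ⟶ k') {b : B} {e : F} (a : (f.obj k).obj (op e))
    (β : b ⟶ p.obj e) :
    ((comp f p.toProfunctor).map κ).app (op b) (lmk p f k a β) =
      lmk p f k' ((f.map κ).app (op e) a) β :=
  rfl

theorem lower_hom_ext {h : Profunctor.{u} K B} {η θ : comp f p.toProfunctor ⟶ h}
    (H : ∀ k (b : B) (e : F) (a : (f.obj k).obj (op e)) (β : b ⟶ p.obj e),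
      (η.app k).app (op b) (lmk p f k a β) = (θ.app k).app (op b) (lmk p f k a β)) : η = θ :=
  comp_hom_ext fun k b e a β => H k b.unop e a β

variable (p) in
/-- `F`, with its elements `s e ∈ W(p e)`, is equivalent over `B` to the category of elements
of `W`. -/
structure IsElements (W : Bᵒᵖ ⥤ Type u) (s : ∀ e, W.obj (op (p.obj e))) : Prop where
  natural : ∀ {e e' : F} (χ : e ⟶ e'), W.map (p.map χ).op (s e') = s e
  exists_iso : ∀ {b : B} (w : W.obj (op b)), ∃ (e : F) (i : b ≅ p.obj e), W.map i.hom.op (s e) = w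
  exists_lift : ∀ {e e' : F} (β : p.obj e ⟶ p.obj e'), W.map β.op (s e') = s e →
    ∃ χ : e ⟶ e', p.map χ = β
  faithful : ∀ {e e' : F} {χ χ' : e ⟶ e'}, p.map χ = p.map χ' → χ = χ'

namespace IsElements

variable {W : Bᵒᵖ ⥤ Type u} {s : ∀ e, W.obj (op (p.obj e))} (h : IsElements p W s)

include h

/-- The element of `W` under an element of `∫^e f(e, k) × B(b, p e)`. -/
def under (f : Profunctor.{u} K F) (k : K) (b : B) :
    ((comp f p.toProfunctor).obj k).obj (op b) → W.obj (op b) :=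
  tlift (fun e _ (β : b ⟶ p.obj e) => W.map β.op (s e)) (fun {e e'} χ _ (β : b ⟶ p.obj e) => by
    change _ = W.map (β ≫ p.map χ).op (s e')
    rw [op_comp, Functor.map_comp, ← h.natural χ]
    rfl)

theorem lmk_id_injective {e : F} {a a' : (f.obj k).obj (op e)}
    (H : lmk p f k a (𝟙 (p.obj e)) = lmk p f k a' (𝟙 (p.obj e))) : a = a' := by
  -- `D` sends the class of `(y, β)` to the set of restrictions of `y` along lifts of `β`. Existence
  -- and uniqueness of lifts make it well defined, and its value at `(a', 𝟙)` is `{a'}`.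
  let D : ((comp f p.toProfunctor).obj k).obj (op (p.obj e)) → Set ((f.obj k).obj (op e)) :=
    tlift (fun e' (y : (f.obj k).obj (op e')) (β : p.obj e ⟶ p.obj e') =>
      {z | ∃ χ : e ⟶ e', p.map χ = β ∧ (f.obj k).map χ.op y = z}) (by
      intro e₁ e₂ ψ x (y : p.obj e ⟶ p.obj e₁)
      ext z
      constructor
      · rintro ⟨χ, rfl, rfl⟩
        exact ⟨χ ≫ ψ, p.map_comp _ _, obj_map_comp_apply f k ψ.op χ.op x⟩
      · rintro ⟨χ, hχ, rfl⟩
        change p.map χ = y ≫ p.map ψ at hχ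
        obtain ⟨χ', rfl⟩ := h.exists_lift y (by
          rw [← h.natural ψ, ← h.natural χ, hχ, op_comp, Functor.map_comp]
          rfl)
        rw [← p.map_comp] at hχ
        obtain rfl := h.faithful hχ
        exact ⟨χ', rfl, (obj_map_comp_apply f k ψ.op χ'.op x).symm⟩)
  have hD : a ∈ D (lmk p f k a (𝟙 (p.obj e))) :=
    ⟨𝟙 e, p.map_id e, obj_map_id_apply f k (op e) a⟩
  rw [H] at hD
  obtain ⟨χ, hχ, rfl⟩ := hD
  obtain rfl := h.faithful (hχ.trans (p.map_id e).symm)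
  exact obj_map_id_apply f k (op e) a'

/-- With `lmk_id_injective`, this identifies `f(e, k)` with the fibre of `under` over `s e`, so `f`
is recovered from its composite with `p_*` and the map to `W`. -/
theorem exists_eq_lmk_id {e : F} (t : ((comp f p.toProfunctor).obj k).obj (op (p.obj e)))
    (ht : h.under f k _ t = s e) : ∃ a, lmk p f k a (𝟙 (p.obj e)) = t := by
  induction t using lmk_ind with | h e' a β =>
  obtain ⟨χ, rfl⟩ := h.exists_lift β ht
  exact ⟨(f.obj k).map χ.op a, (lmk_glide _ _ _).trans (by rw [Category.id_comp])⟩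

theorem compMap_faithful {σ τ : f ⟶ g}
    (H : compMap σ (𝟙 p.toProfunctor) = compMap τ (𝟙 p.toProfunctor)) : σ = τ := by
  refine prof_hom_ext fun k e a => h.lmk_id_injective (p := p) (e := e.unop) ?_
  exact congrArg (fun η : comp f p.toProfunctor ⟶ comp g p.toProfunctor =>
    (η.app k).app (op (p.obj e.unop)) (lmk p f k a (𝟙 (p.obj e.unop)))) H

/-- Being a map over `W`, `θ` restricts to the fibres over each `s e`, and these restrictions form
`σ`. -/
theorem compMap_full (θ : comp f p.toProfunctor ⟶ comp g p.toProfunctor)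
    (hθ : ∀ k (b : B) (t : ((comp f p.toProfunctor).obj k).obj (op b)),
      h.under g k b ((θ.app k).app (op b) t) = h.under f k b t) :
    ∃ σ : f ⟶ g, compMap σ (𝟙 p.toProfunctor) = θ := by
  have H (k : K) (e : F) (a : (f.obj k).obj (op e)) : ∃ a' : (g.obj k).obj (op e),
      lmk p g k a' (𝟙 (p.obj e)) = (θ.app k).app (op (p.obj e)) (lmk p f k a (𝟙 _)) :=
    h.exists_eq_lmk_id _ ((hθ _ _ _).trans (obj_map_id_apply ((Functor.const K).obj W)
      k (op (p.obj e)) (s e)))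
  choose φ hφ using H
  have hφ' (k : K) (b : B) (e : F) (a : (f.obj k).obj (op e)) (β : b ⟶ p.obj e) :
      (θ.app k).app (op b) (lmk p f k a β) = lmk p g k (φ k e a) β := by
    have := app_obj_map θ k β.op (lmk p f k a (𝟙 _))
    rw [← hφ, map_lmk, map_lmk, Category.comp_id] at this
    exact this
  let σ : f ⟶ g :=
    { app := fun k =>
        { app := fun e => ↾(φ k e.unop)
          naturality := fun e e' χ => by
            ext a
            refine h.lmk_id_injective (p := p) ?_
            change lmk p g k (φ k e'.unop ((f.obj k).map χ a)) _ =
              lmk p g k ((g.obj k).map χ.unop.op (φ k e.unop a)) _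
            rw [hφ, lmk_glide, ← hφ', ← lmk_glide]
            rfl }
      naturality := fun k k' κ => by
        ext e a
        refine h.lmk_id_injective (p := p) (e := e.unop) ?_
        change lmk p g k' (φ k' e.unop ((f.map κ).app e a)) _ =
          lmk p g k' ((g.map κ).app (op e.unop) (φ k e.unop a)) _
        rw [hφ, ← map_app_lmk, ← map_app_lmk, hφ, ← app_map_app] }
  exact ⟨σ, lower_hom_ext fun k b e a β => (hφ' k b e a β).symm⟩

/-- The module `f` consists of the fibres of `γ`: `f(e, k)` is the fibre over `s e`. -/
theorem exists_comp_iso (g : Profunctor.{u} K B) (γ : g ⟶ (Functor.const K).obj W) :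
    ∃ (f : Profunctor.{u} K F) (i : comp f p.toProfunctor ≅ g),
      ∀ k (b : B) (t : ((comp f p.toProfunctor).obj k).obj (op b)),
        (γ.app k).app (op b) ((i.hom.app k).app (op b) t) = h.under f k b t := by
  let f : Profunctor.{u} K F :=
    { obj := fun k =>
        { obj := fun e => {a : (g.obj k).obj (op (p.obj e.unop)) // (γ.app k).app _ a = s e.unop}
          map := fun χ => ↾fun a => ⟨(g.obj k).map (p.map χ.unop).op a.1, by
            rw [app_obj_map, a.2]
            exact h.natural χ.unop⟩
          map_id := fun e => by
            ext a
            exact (congrArg (fun φ => (g.obj k).map (Quiver.Hom.op φ) a.1)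
              (p.map_id e.unop)).trans (obj_map_id_apply g k _ a.1)
          map_comp := fun χ χ' => by
            ext a
            exact (congrArg (fun φ => (g.obj k).map (Quiver.Hom.op φ) a.1)
              (p.map_comp χ'.unop χ.unop)).trans (obj_map_comp_apply g k _ _ a.1) }
      map := fun κ =>
        { app := fun e => ↾fun a => ⟨(g.map κ).app _ a.1, by
            rw [app_map_app, a.2]; rfl⟩
          naturality := fun e e' χ => by
            ext a
            exact map_app_obj_map g κ _ a.1 }
      map_id := fun k => by
        ext e a
        exact map_id_apply g k _ a.1
      map_comp := fun κ κ' => by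
        ext e a
        exact map_comp_apply g _ κ κ' a.1 }
  let i : comp f p.toProfunctor ⟶ g :=
    { app := fun k =>
        { app := fun b => ↾(tlift (fun e a (β : b.unop ⟶ p.obj e) => (g.obj k).map β.op a.1)
            (fun {e e'} χ a (β : b.unop ⟶ p.obj e) =>
              ((congrArg (fun φ => (g.obj k).map φ a.1)
                (op_comp (f := β) (g := p.map χ))).trans
                (obj_map_comp_apply g k (p.map χ).op β.op a.1)).symm))
          naturality := fun b b' γ => by
            ext t
            induction t using tensor_ind with | h e a β =>
            exact obj_map_comp_apply g k (Quiver.Hom.op β) γ a.1 }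
      naturality := fun k k' κ => by
        ext b t
        induction t using tensor_ind with | h e a β =>
        exact (map_app_obj_map g κ (Quiver.Hom.op β) a.1).symm }
  have hi (k : K) (b : B) (e : F) (a : (f.obj k).obj (op e)) (β : b ⟶ p.obj e) :
      (i.app k).app (op b) (lmk p f k a β) = (g.obj k).map β.op a.1 := rfl
  have key (k : K) (b : B) (t : ((comp f p.toProfunctor).obj k).obj (op b)) :
      (γ.app k).app (op b) ((i.app k).app (op b) t) = h.under f k b t := by
    induction t using lmk_ind with | h e a β =>
    rw [hi, app_obj_map, a.2]
    rfl
  -- Over an element of `W` of the form `s e` restricted along an isomorphism `j`, every class has a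
  -- representative with second component `j`. Two classes with the same image in `g` can thus be
  -- compared by their first components.
  have normal {k : K} {b : B} {e : F} (j : b ≅ p.obj e)
      (t : ((comp f p.toProfunctor).obj k).obj (op b))
      (ht : h.under f k b t = W.map j.hom.op (s e)) :
      ∃ a : (f.obj k).obj (op e), t = lmk p f k a j.hom := by
    induction t using lmk_ind with | h e' a β =>
    obtain ⟨χ, hχ⟩ := h.exists_lift (j.inv ≫ β) (by
      rw [map_op_comp_apply, map_inv_op_apply_eq_iff]
      exact ht)
    exact ⟨(f.obj k).map χ.op a, ((lmk_glide _ _ _).trans (by rw [hχ]; simp)).symm⟩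
  have hbij : ∀ (k : K) (b : B), Function.Bijective ((i.app k).app (op b)) := by
    refine fun k b => ⟨fun t t' e => ?_, fun y => ?_⟩
    · obtain ⟨e₀, j, hj⟩ := h.exists_iso (h.under f k b t)
      obtain ⟨a, rfl⟩ := normal j t hj.symm
      obtain ⟨a', rfl⟩ := normal j t' (by rw [hj, ← key, ← key, e])
      rw [hi, hi, ← map_inv_op_apply_eq_iff, ← map_op_comp_apply, j.inv_hom_id] at e
      have : a = a' := Subtype.ext ((obj_map_id_apply g k _ _).symm.trans e)
      rw [this]
    · obtain ⟨e₀, j, hj⟩ := h.exists_iso ((γ.app k).app (op b) y)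
      refine ⟨lmk p f k ⟨(g.obj k).map j.inv.op y, ?_⟩ j.hom, ?_⟩
      · rw [app_obj_map]
        exact (map_inv_op_apply_eq_iff W j _ _).2 hj.symm
      · exact ((map_inv_op_apply_eq_iff (g.obj k) j _ _).1 rfl).symm
  have := isIso_of_bijective i hbij
  exact ⟨f, asIso i, key⟩

end IsElements

end Lower

end ModBicat

namespace BicatNotions

open Bicategory

theorem isLeftAdjoint_of_triangles {M : Type*} [Bicategory M] {X Y : M} {f : X ⟶ Y} {g : Y ⟶ X}
    (η : 𝟙 X ⟶ f ≫ g) (ε' : g ≫ f ⟶ 𝟙 Y)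
    (h₁ : η ▷ f ≫ (α_ _ _ _).hom ≫ f ◁ ε' ≫ (ρ_ f).hom = (λ_ f).hom)
    (h₂ : g ◁ η ≫ (α_ _ _ _).inv ≫ ε' ▷ g ≫ (λ_ g).hom = (ρ_ g).hom) : IsLeftAdjoint f := by
  refine .mk ⟨η, ε', ?_, ?_⟩
  · rw [← h₁]
    simp [bicategoricalComp]
  · rw [← h₂]
    simp [bicategoricalComp]

theorem left_triangle_unitors {M : Type*} [Bicategory M] {X Y : M} {f : X ⟶ Y} {g : Y ⟶ X}
    (adj : f ⊣ g) :
    adj.unit ▷ f ≫ (α_ _ _ _).hom ≫ f ◁ adj.counit ≫ (ρ_ f).hom = (λ_ f).hom := by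
  rw [← cancel_mono (ρ_ f).inv]
  refine Eq.trans ?_ adj.left_triangle
  simp [bicategoricalComp, -Bicategory.Adjunction.left_triangle]

end BicatNotions

/-! ### Left adjoints, right liftings and the terminal object in `Mod`. -/

namespace ModCat

open Opposite Bicategory ModBicat BicatNotions

/-- The right adjoint is `(e, b) ↦ B(p e, b)`; the unit is the action of `p` on morphisms and the
counit is composition in `B`. -/
theorem isLeftAdjoint_lowerStar {E B : ModCat.{u}} (p : E.carrier ⥤ B.carrier) :
    IsLeftAdjoint (lowerStar p) := by
  let P : Profunctor.{u} E.carrier B.carrier := p.toProfunctor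
  let Q : Profunctor.{u} B.carrier E.carrier := p.toProfunctorRev
  let η : Profunctor.id (C := E.carrier) ⟶ comp P Q :=
    { app := fun e =>
        { app := fun e' => ↾(fun χ : e'.unop ⟶ e =>
            tmk P Q e e' (p.obj e) (𝟙 (p.obj e)) (p.map χ))
          naturality := fun e₁ e₂ ψ => by
            ext χ
            exact congrArg (tmk P Q e e₂ (p.obj e) (𝟙 (p.obj e))) (p.map_comp ψ.unop χ) }
      naturality := fun e e' χ => by
        ext e₁ ψ
        refine (congrArg (tmk P Q e' e₁ (p.obj e') (𝟙 (p.obj e'))) (p.map_comp ψ χ)).trans ?_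
        refine (tmk_glide P Q e' e₁ (p.map χ) (𝟙 (p.obj e')) (p.map ψ)).symm.trans ?_
        exact congrArg (fun z => tmk P Q e' e₁ (p.obj e) z (p.map ψ))
          ((Category.comp_id (p.map χ)).trans (Category.id_comp (p.map χ)).symm) }
  let ε' : comp Q P ⟶ Profunctor.id (C := B.carrier) :=
    { app := fun b =>
        { app := fun b' => ↾(tlift (fun e (y : p.obj e ⟶ b) (z : b'.unop ⟶ p.obj e) => z ≫ y)
            (fun {e e'} χ (y : p.obj e' ⟶ b) (z : b'.unop ⟶ p.obj e) =>
              (Category.assoc z (p.map χ) y).symm))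
          naturality := fun b₁ b₂ ψ => by
            ext t
            induction t using tensor_ind with | h e y z =>
            exact Category.assoc ψ.unop (show b₁.unop ⟶ p.obj e from z) _ }
      naturality := fun b b' β => by
        ext b₁ t
        induction t using tensor_ind with | h e y z =>
        exact (Category.assoc (show b₁.unop ⟶ p.obj e from z) _ _).symm }
  refine isLeftAdjoint_of_triangles (f := lowerStar p) (g := (Q : B ⟶ E)) η ε' ?_ ?_
  · refine comp_hom_ext fun e b e' χ β => ?_
    change b.unop ⟶ p.obj e' at β
    change e' ⟶ e at χ
    exact Category.comp_id (β ≫ p.map χ)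
  · refine comp_hom_ext fun b e e' y χ => ?_
    change p.obj e' ⟶ b at y
    change e.unop ⟶ e' at χ
    change p.map χ ≫ 𝟙 _ ≫ y = p.map χ ≫ y
    simp

/-- All modules are right lifters: the right lifting of `w` through `n` is
`(y, k) ↦ Hom(n(-, y), w(-, k))`. -/
theorem isRightLifter {Y Z : ModCat.{u}} (n : Y ⟶ Z) : IsRightLifter n := by
  intro K w
  let N : Profunctor.{u} Y.carrier Z.carrier := n
  let W : Profunctor.{u} K.carrier Z.carrier := w
  let R : Profunctor.{u} K.carrier Y.carrier :=
    W ⋙ yoneda ⋙ (Functor.whiskeringLeft _ _ _).obj (Functor.op N)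
  let ϖ : comp R N ⟶ W :=
    { app := fun k =>
        { app := fun z => ↾(tlift (fun y (a : N.obj y ⟶ W.obj k) b => a.app z b)
            (fun f a b => rfl))
          naturality := fun z z' g => by
            ext t
            induction t using tensor_ind with | h y a b =>
            exact ConcreteCategory.congr_hom
              ((show N.obj y ⟶ W.obj k from a).naturality g) b }
      naturality := fun k k' f => by
        ext z t
        induction t using tensor_ind with | h y a b => rfl }
  refine ⟨(R : K ⟶ Y), ϖ, fun v => ⟨fun σ τ h => ?_, fun τ => ?_⟩⟩
  · refine prof_hom_ext (P := v) (Q := R) fun k y a => ?_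
    refine NatTrans.ext (funext fun z => ?_)
    ext b
    exact congrArg (fun η : comp v N ⟶ W => (η.app k).app z (tmk v N k z y.unop a b)) h
  · let V : Profunctor.{u} K.carrier Y.carrier := v
    change comp V N ⟶ W at τ
    let σ : V ⟶ R :=
      { app := fun k =>
          { app := fun y => ↾(fun a =>
              ({ app := fun z => ↾(fun b => (τ.app k).app z (tmk V N k z y.unop a b))
                 naturality := fun z z' g => by
                  ext b
                  exact app_obj_map τ k g (tmk V N k z y.unop a b) } :
                N.obj y.unop ⟶ W.obj k))
            naturality := fun y y' g => by
              ext a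
              refine NatTrans.ext (funext fun z => ?_)
              ext b
              exact congrArg ((τ.app k).app z) (tmk_glide V N k z g.unop a b) }
        naturality := fun k k' f => by
          ext y a
          refine NatTrans.ext (funext fun z => ?_)
          ext b
          exact app_map_app τ z f (tmk V N k z y.unop a b) }
    exact ⟨σ, comp_hom_ext (P := V) (Q := N) fun k z y a b => rfl⟩

/-- The terminal category. -/
def point : ModCat.{u} := ⟨Discrete PUnit.{u + 1}⟩

/-- The presheaf underlying a module out of `point`. -/
def presheaf {X : ModCat.{u}} (x : point ⟶ X) : X.carrierᵒᵖ ⥤ Type u :=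
  (show Profunctor.{u} (Discrete PUnit.{u + 1}) X.carrier from x).obj ⟨⟨⟩⟩

/-- The module out of `point` of a presheaf. -/
def ofPresheaf {X : ModCat.{u}} (W : X.carrierᵒᵖ ⥤ Type u) : point ⟶ X :=
  (show Profunctor.{u} (Discrete PUnit.{u + 1}) X.carrier from (Functor.const _).obj W)

/-- The module `X ⟶ point` with singleton values. -/
def bang (X : ModCat.{u}) : X ⟶ point :=
  (show Profunctor.{u} X.carrier (Discrete PUnit.{u + 1}) from
    (Functor.const _).obj ((Functor.const _).obj PUnit.{u + 1}))

/-- `bang X` is terminal. -/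
def isTerminalBang (X : ModCat.{u}) : Limits.IsTerminal (bang X) :=
  Limits.IsTerminal.ofUniqueHom
    (fun f => (show (f : Profunctor.{u} X.carrier (Discrete PUnit.{u + 1})) ⟶ _ from
      { app := fun x => { app := fun i => ↾(fun _ => PUnit.unit) } }))
    (fun f η => prof_hom_ext fun x i a => rfl)

theorem nonempty_iso_bang {X : ModCat.{u}} (f : X ⟶ point)
    (h : ∀ x : X.carrier, Nonempty (Unique
      (((f : Profunctor.{u} X.carrier (Discrete PUnit.{u + 1})).obj x).obj (op ⟨⟨⟩⟩)))) :
    Nonempty (f ≅ bang X) := by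
  have : IsIso ((isTerminalBang X).from f) := isIso_of_bijective _ fun x i => by
    obtain ⟨hx⟩ := h x
    refine ⟨fun a b _ => ?_, fun b => ⟨hx.default, rfl⟩⟩
    exact (hx.uniq a).trans (hx.uniq b).symm
  exact ⟨asIso ((isTerminalBang X).from f)⟩

theorem isLeftAdjoint_bang (X : ModCat.{u}) : IsLeftAdjoint (bang X) := by
  let p : X.carrier ⥤ point.{u}.carrier := (Functor.const _).obj (⟨⟨⟩⟩ : Discrete PUnit.{u + 1})
  obtain ⟨i⟩ := nonempty_iso_bang (lowerStar p) fun x =>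
    ⟨⟨⟨𝟙 (⟨⟨⟩⟩ : Discrete PUnit.{u + 1})⟩, fun a => Subsingleton.elim
      (α := (⟨⟨⟩⟩ : Discrete PUnit.{u + 1}) ⟶ ⟨⟨⟩⟩) _ _⟩⟩
  exact isLeftAdjoint_of_iso i (isLeftAdjoint_lowerStar p)

/-- Let the unit at `𝟙 x` be the class of `(a₀, b₀)`. The triangle identity sends any `a` to `a₀`
acted on by the counit at `(b₀, a)`. This is an endomorphism of the point, hence an identity, so `a
= a₀`. -/
theorem nonempty_unique_of_isLeftAdjoint {X : ModCat.{u}} (f : X ⟶ point)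
    (h : IsLeftAdjoint f) (x : X.carrier) : Nonempty (Unique
      (((f : Profunctor.{u} X.carrier (Discrete PUnit.{u + 1})).obj x).obj (op ⟨⟨⟩⟩))) := by
  let adj := Adjunction.ofIsLeftAdjoint f
  let F : Profunctor.{u} X.carrier (Discrete PUnit.{u + 1}) := f
  let G : Profunctor.{u} (Discrete PUnit.{u + 1}) X.carrier := rightAdjoint f
  let η : Profunctor.id (C := X.carrier) ⟶ comp F G := adj.unit
  let ω : comp F (comp G F) ⟶ F := f ◁ adj.counit ≫ (ρ_ f).hom
  let j : (Discrete PUnit.{u + 1})ᵒᵖ := op ⟨⟨⟩⟩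
  obtain ⟨⟨i, a₀, b₀⟩, h₀⟩ := Quot.exists_rep ((η.app x).app (op x) (𝟙 x))
  refine ⟨⟨⟨a₀⟩, fun a => ?_⟩⟩
  have key := congrArg (fun κ : comp (Profunctor.id (C := X.carrier)) F ⟶ F => (κ.app x).app j
    (tmk (Profunctor.id (C := X.carrier)) F x j x (𝟙 x) a)) (left_triangle_unitors adj)
  refine (map_id_apply F x j a).symm.trans (key.symm.trans ?_)
  refine (congrArg (fun t => (ω.app x).app j (((assoc F G F).hom.app x).app j
    (tmk (comp F G) F x j x t a))) h₀.symm).trans ?_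
  exact obj_map_id_apply F x j a₀


/-- `point` has the terminal property required of the object `1`. -/
def star : StarTerminal point.{u} where
  bang := bang
  isLeftAdjoint_bang := isLeftAdjoint_bang
  nonempty_iso _ f hf := nonempty_iso_bang f (nonempty_unique_of_isLeftAdjoint f hf)
  isTerminal := isTerminalBang

/-- The composite `x !_K` is constant in `K`. -/
def evalBang (K : ModCat.{u}) {X : ModCat.{u}} (x : point ⟶ X) :
    comp (bang K : Profunctor.{u} K.carrier (Discrete PUnit.{u + 1})) x ⟶
      (Functor.const K.carrier).obj (presheaf x) where
  app k :=
    { app := fun b => ↾(tlift (fun i _ w => w) (fun {i j} f _ w =>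
        (map_id_apply (show Profunctor.{u} (Discrete PUnit.{u + 1}) X.carrier from x)
          ⟨⟨⟩⟩ b w).symm))
      naturality := fun b b' g => by
        ext t
        induction t using tensor_ind with | h i _ w => rfl }
  naturality k k' f := by
    ext b t
    induction t using tensor_ind with | h i _ w => rfl

theorem isIso_evalBang (K : ModCat.{u}) {X : ModCat.{u}} (x : point ⟶ X) :
    IsIso (evalBang K x) :=
  isIso_of_bijective _ fun k b => by
    let mk (w : (presheaf x).obj (op b)) :=
      tmk (bang K : Profunctor.{u} K.carrier (Discrete PUnit.{u + 1})) x k (op b) ⟨⟨⟩⟩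
        PUnit.unit w
    refine ⟨fun t t' h => ?_, fun w => ⟨mk w, rfl⟩⟩
    induction t using tensor_ind with | h i _ w =>
    induction t' using tensor_ind with | h i' _ w' =>
    exact congrArg mk h

theorem evalBang_collapse {K F X : ModCat.{u}} (f : K ⟶ F) (x : point ⟶ X) (k : K.carrier)
    (b : X.carrierᵒᵖ) (e : F.carrier) (a)
    (t : Tensor (bang F : Profunctor.{u} F.carrier (Discrete PUnit.{u + 1})) x e b) :
    ((evalBang K x).app k).app b (((star.collapse f x).app k).app b
      (tmk f (comp (bang F : Profunctor.{u} F.carrier (Discrete PUnit.{u + 1})) x) k b e a t)) =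
    ((evalBang F x).app e).app b t := by
  induction t using tensor_ind with | h i _ w => rfl

/-- Under `evalBang`, the cells of `ρ` become the maps `under`, so the three properties of a
tabulation are `compMap_faithful`, `compMap_full` and `exists_comp_iso`. -/
theorem exists_tabulates {F B : ModCat.{u}} (p : F.carrier ⥤ B.carrier) (x : point ⟶ B)
    (s : ∀ e, (presheaf x).obj (op (p.obj e))) (h : IsElements p (presheaf x) s) :
    ∃ ρ : lowerStar p ⟶ star.bang F ≫ x, star.Tabulates ρ := by
  let ρ₀ : p.toProfunctor ⟶ (Functor.const F.carrier).obj (presheaf x) :=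
    { app := fun e =>
        { app := fun b => ↾(fun β : b.unop ⟶ p.obj e => (presheaf x).map β.op (s e))
          naturality := fun b b' γ => by
            ext β
            exact map_op_comp_apply (presheaf x) γ.unop β (s e) }
      naturality := fun e e' χ => by
        ext b β
        refine (map_op_comp_apply (presheaf x) (show b.unop ⟶ p.obj e from β) (p.map χ)
          (s e')).trans ?_
        rw [h.natural]
        rfl }
  have := isIso_evalBang F x
  obtain ⟨ρ₁, hρ₁⟩ : ∃ ρ₁ : p.toProfunctor ⟶ comp (bang F : Profunctor.{u} F.carrier
      (Discrete PUnit.{u + 1})) x, ρ₁ ≫ evalBang F x = ρ₀ := ⟨ρ₀ ≫ inv (evalBang F x), by simp⟩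
  let ρ : lowerStar p ⟶ star.bang F ≫ x := ρ₁
  have hρ (K : ModCat.{u}) (f : K ⟶ F) (k : K.carrier) (b : B.carrier)
      (t : ((comp f p.toProfunctor).obj k).obj (op b)) :
      ((evalBang K x).app k).app (op b) (((star.cell ρ f).app k).app (op b) t) =
        h.under f k b t := by
    induction t using lmk_ind with | h e a β =>
    refine (evalBang_collapse f x k (op b) e a ((ρ₁.app e).app (op b) β)).trans ?_
    exact congrArg (fun η : p.toProfunctor ⟶ _ => (η.app e).app (op b) β) hρ₁
  refine ⟨ρ, fun {K f g σ τ} e => h.compMap_faithful e, fun {K f g} θ hθ => ?_,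
    fun {K} g γ => ?_⟩
  · refine h.compMap_full θ fun k b t => ?_
    rw [← hρ, ← hρ, ← hθ]
    rfl
  · obtain ⟨f, i, hi⟩ := h.exists_comp_iso g (γ ≫ evalBang K x)
    have := isIso_evalBang K x
    refine ⟨f, i, (cancel_mono (evalBang K x)).1 ?_⟩
    exact lower_hom_ext fun k b e a β => (hi k b _).trans (hρ K f k b _).symm


/-! ### Categories of elements are discrete fibrations. -/

section Elements

variable {B : Type u} [SmallCategory B] (W : Bᵒᵖ ⥤ Type u)

/-- The projection of the category of elements of a presheaf. -/
abbrev elementsProj : W.Elementsᵒᵖ ⥤ B := (CategoryOfElements.π W).leftOp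

theorem isElements_elementsProj : IsElements (elementsProj W) W (fun e => e.unop.2) where
  natural χ := χ.unop.2
  exists_iso {b} w := ⟨op ⟨op b, w⟩, Iso.refl b, ConcreteCategory.congr_hom (W.map_id (op b)) w⟩
  exists_lift {e e'} β h := ⟨Quiver.Hom.op ⟨β.op, h⟩, rfl⟩
  faithful {e e' χ χ'} h := by
    refine Quiver.Hom.unop_inj (CategoryOfElements.ext _ _ _ ?_)
    exact Quiver.Hom.unop_inj h

theorem isDiscreteFibration_elementsProj : IsDiscreteFibration (elementsProj W) := by
  intro e b β
  let χ : (op ⟨op b, W.map β.op e.unop.2⟩ : W.Elementsᵒᵖ) ⟶ e := Quiver.Hom.op ⟨β.op, rfl⟩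
  refine ⟨⟨_, χ⟩, IsHomLift.map (elementsProj W) χ, ?_⟩
  rintro ⟨⟨⟨b', w⟩⟩, ⟨⟨ψ, hψ⟩⟩⟩ h
  change e.unop.1 ⟶ b' at ψ
  obtain rfl : W.map ψ e.unop.2 = w := hψ
  obtain rfl : b'.unop = b := @IsHomLift.domain_eq _ _ _ _ (elementsProj W) _ _ _ _ β _ h
  obtain rfl : β = ψ.unop := @IsHomLift.eq_of_isHomLift _ _ _ _ (elementsProj W)
    (op ⟨b', W.map ψ e.unop.2⟩) e β _ h
  rfl

end Elements

/-! ### Discrete fibrations as categories of elements of their fibres. -/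

section DiscreteFibration

variable {E B : Type u} [SmallCategory E] [SmallCategory B] {p : E ⥤ B}
  (hp : IsDiscreteFibration p)

include hp

theorem exists_lift_of_isDiscreteFibration {b b' : B} (β : b' ⟶ b) (e : {e : E // p.obj e = b}) :
    ∃ (e' : {e : E // p.obj e = b'}) (χ : e'.1 ⟶ e.1), p.IsHomLift β χ := by
  obtain ⟨e, rfl⟩ := e
  obtain ⟨⟨e', χ⟩, h, -⟩ := hp e b' β
  exact ⟨⟨e', IsHomLift.domain_eq p β χ⟩, χ, h⟩

theorem sigma_eq_of_isHomLift {b b' : B} {β : b' ⟶ b} {e e₁ e₂ : E} (χ₁ : e₁ ⟶ e) (χ₂ : e₂ ⟶ e)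
    (h₁ : p.IsHomLift β χ₁) (h₂ : p.IsHomLift β χ₂) :
    (⟨e₁, χ₁⟩ : Σ e' : E, e' ⟶ e) = ⟨e₂, χ₂⟩ := by
  obtain rfl := IsHomLift.codomain_eq p β χ₁
  exact (hp e b' β).unique h₁ h₂

/-- The action of the base on the fibres of a discrete fibration. -/
noncomputable def fibreMap {b b' : B} (β : b' ⟶ b) (e : {e : E // p.obj e = b}) :
    {e : E // p.obj e = b'} :=
  (exists_lift_of_isDiscreteFibration hp β e).choose

theorem fibreMap_eq_iff {b b' : B} (β : b' ⟶ b) (e : {e : E // p.obj e = b})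
    (e' : {e : E // p.obj e = b'}) :
    fibreMap hp β e = e' ↔ ∃ χ : e'.1 ⟶ e.1, p.IsHomLift β χ := by
  have h := (exists_lift_of_isDiscreteFibration hp β e).choose_spec
  refine ⟨?_, fun ⟨χ, hχ⟩ => ?_⟩
  · rintro rfl
    exact h
  · obtain ⟨χ', hχ'⟩ := h
    exact Subtype.ext (congrArg Sigma.fst (sigma_eq_of_isHomLift hp χ' χ hχ' hχ))

/-- The presheaf of fibres of a discrete fibration. -/
noncomputable def fibres : Bᵒᵖ ⥤ Type u where
  obj b := {e : E // p.obj e = b.unop}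
  map β := ↾(fibreMap hp β.unop)
  map_id b := by
    refine ConcreteCategory.hom_ext _ _ fun e => ?_
    exact (fibreMap_eq_iff hp _ e e).2 ⟨𝟙 _, IsHomLift.id e.2⟩
  map_comp β γ := by
    refine ConcreteCategory.hom_ext _ _ fun e => ?_
    obtain ⟨χ, hχ⟩ := (fibreMap_eq_iff hp β.unop e _).1 rfl
    obtain ⟨ψ, hψ⟩ := (fibreMap_eq_iff hp γ.unop (fibreMap hp β.unop e) _).1 rfl
    refine (fibreMap_eq_iff hp _ e _).2 ⟨ψ ≫ χ, ?_⟩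
    exact inferInstanceAs (p.IsHomLift (γ.unop ≫ β.unop) (ψ ≫ χ))

/-- The chosen element over `e` is `e` itself, in its own fibre; restriction along `β` then takes
`e'` to `e` exactly when `β` lifts to a morphism `e ⟶ e'`. -/
theorem isElements_of_isDiscreteFibration : IsElements p (fibres hp) (fun e => ⟨e, rfl⟩) where
  natural χ := (fibreMap_eq_iff hp _ _ _).2 ⟨χ, IsHomLift.map p χ⟩
  exists_iso {b} w := by
    obtain ⟨e, he⟩ := w
    obtain rfl : p.obj e = b := he
    exact ⟨e, Iso.refl _, (fibreMap_eq_iff hp _ _ _).2 ⟨𝟙 e, IsHomLift.id rfl⟩⟩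
  exists_lift {e e'} β h := by
    obtain ⟨χ, hχ⟩ := (fibreMap_eq_iff hp _ _ _).1 h
    exact ⟨χ, (@IsHomLift.eq_of_isHomLift _ _ _ _ p e e' β χ hχ).symm⟩
  faithful {e e' χ χ'} h :=
    eq_of_heq (Sigma.mk.inj (sigma_eq_of_isHomLift hp χ χ' (IsHomLift.map p χ)
      (h ▸ IsHomLift.map p χ'))).2

end DiscreteFibration

theorem exists_tabulation {X : ModCat.{u}} (x : point ⟶ X) :
    ∃ (F : ModCat.{u}) (p : F.carrier ⥤ X.carrier) (ρ : lowerStar p ⟶ star.bang F ≫ x),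
      IsDiscreteFibration p ∧ star.Tabulates ρ := by
  let F : ModCat.{u} := ⟨(presheaf x).Elementsᵒᵖ⟩
  obtain ⟨ρ, hρ⟩ := exists_tabulates (F := F) (elementsProj (presheaf x)) x _
    (isElements_elementsProj (presheaf x))
  exact ⟨F, _, ρ, isDiscreteFibration_elementsProj _, hρ⟩

theorem tab_lowerStar {F B : ModCat.{u}} {p : F.carrier ⥤ B.carrier}
    (hp : IsDiscreteFibration p) : Tab (lowerStar p) := by
  obtain ⟨ρ, hρ⟩ := exists_tabulates p (ofPresheaf (fibres hp)) _
    (isElements_of_isDiscreteFibration hp)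
  exact (star.tab_iff _).2 ⟨isLeftAdjoint_lowerStar p, _, ρ, hρ⟩

end ModCat

/-- `Mod` is calibrated by `Tab`, all of its morphisms are right lifters and, up to equivalence, the
neat morphisms are those of the form `p_*` with `p` a discrete fibration. -/
theorem mainTheorem7 :
    BicatNotions.IsCalibration (M := ModCat.{u}) BicatNotions.Tab ∧
    (∀ {A B : ModCat.{u}} (m : A ⟶ B), BicatNotions.IsRightLifter m) ∧
    (∀ {E B : ModCat.{u}} (m : E ⟶ B), BicatNotions.Tab m ↔
      ∃ (F : ModCat.{u}) (h : F ⟶ E) (p : F.carrier ⥤ B.carrier),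
        BicatNotions.IsEquivalenceMor h ∧ IsDiscreteFibration p ∧
          Nonempty (h ≫ m ≅ ModCat.lowerStar p)) := by
  refine ⟨ModCat.star.isCalibration_tab fun x => ?_, ModCat.isRightLifter, fun {E B} m => ?_⟩
  · obtain ⟨F, p, ρ, -, hρ⟩ := ModCat.exists_tabulation x
    exact ⟨F, _, ρ, ModCat.isLeftAdjoint_lowerStar p, hρ⟩
  · constructor
    · intro hm
      obtain ⟨-, x, ρ, h⟩ := (ModCat.star.tab_iff m).1 hm
      obtain ⟨F, p, ρ', hp, h'⟩ := ModCat.exists_tabulation x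
      -- Both `m` and the projection of the category of elements tabulate `x`.
      obtain ⟨f, hf, hi⟩ := h.exists_equivalence h'
      exact ⟨F, f, p, hf, hp, hi⟩
    · rintro ⟨F, _, p, ⟨e, rfl⟩, hp, ⟨i⟩⟩
      -- `m` is isomorphic to `p_*` precomposed with the inverse equivalence.
      refine ModCat.star.tab_of_iso (ModCat.star.tab_precomp
        (BicatNotions.isEquivalenceMor_inv e) (ModCat.tab_lowerStar hp)) ?_
      exact Bicategory.whiskerLeftIso e.inv i.symm ≪≫ (Bicategory.associator _ _ _).symm ≪≫
        Bicategory.whiskerRightIso e.counit m ≪≫ Bicategory.leftUnitor m
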